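/- Let $S\subset\mathbb{R}^2$ be a fixed bounded region of positive area (with the area law uniform on it), let $r_0>0$ be a minimum distance such that no disc of radius $r_0$ centred at a point of $\overline{S}$ covers $S$ up to a null set, let $b>0$ be the amplitude loss exponent, and let $\zeta$ be a fading law with $\zeta([0,z_1])=1$ for some $z_1<\infty$ and $\zeta((0,\infty))>0$. Consider dense random networks with $N_{\rm b}$ anchors (known positions) and $N_{\rm a}\ge 1$ agents (unknown positions): the positions $\mathbf p_j$ of all nodes are independent and uniform in $S$. Agent $k$ receives from every anchor, and from every other agent, a multipath waveform $r_{kj}(t)=\sum_{l=1}^{L_{kj}}\alpha_{kj}^{(l)}s(t-\tau_{kj}^{(l)})+z_{kj}(t)$, $0\le t<T_{\rm ob}$, in independent white Gaussian noise of two-sided spectral density $N_0/2$, with delays $\tau_{kj}^{(l)}=(\|\mathbf p_k-\mathbf p_j\|+b_{kj}^{(l)})/c$ and range biases $b_{kj}^{(l)}\ge0$ ($b_{kj}^{(1)}=0$ and known in line of sight). The agents' positions and all amplitudes and other biases are unknown parameters without prior knowledge, and the multipath parameters of each waveform have a nonsingular Fisher information matrix. The ranging information intensity $\lambda_{kj}$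 of $r_{kj}$, that is, the equivalent Fisher information (Schur complement) for the distance $d_{kj}=\|\mathbf p_k-\mathbf p_j\|$ after elimination of the multipath parameters, is $\lambda_{kj}=Z_{kj}\,d_{kj}^{-2b}$ if $d_{kj}\ge r_0$ and $0$ otherwise, where the fading variables $Z_{kj}$ are i.i.d. with law $\zeta$ and independent of the positions. The squared position error bound of agent $k$ is $\mathcal P(\mathbf p_k)=\operatorname{tr}\{[\mathbf J_{\theta}^{-1}]_{2\times2,k}\}$, where $\mathbf J_\theta$ is the Fisher information matrix of all unknown parameters given all received waveforms (cooperative localization), or of the position of agent $k$ and its channel parameters given only the waveforms that agent $k$ receives from the anchors (non-cooperative localization), and $[\cdot]_{2\times 2,k}$ is the block of the position of agent $k$. Then there are deterministic constants $0<c_1<c_2<\infty$ and a sequence $\varepsilon(N_{\rm b})\to0$ as $N_{\rm b}\to\infty$ such that for all $N_{\rm b}$, all $N_{\rm a}\ge1$ and every agent $k$, for non-cooperative localization $$\mathbb P\Big\{\frac{c_1}{N_{\rm b}}\le\mathcal P(\mathbf p_k)\le\frac{c_2}{N_{\rm b}}\Big\}\ \ge\ 1-\varepsilon(N_{\rm b}),$$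 and (with possibly other $c_1,c_2,\varepsilon$ of the same kind) for cooperative localization $$\mathbb P\Big\{\frac{c_1}{N_{\rm b}+N_{\rm a}}\le\mathcal P(\mathbf p_k)\le\frac{c_2}{N_{\rm b}+N_{\rm a}}\Big\}\ \ge\ 1-\varepsilon(N_{\rm b}).$$ -/

import Mathlib

open MeasureTheory ProbabilityTheory Filter Topology

noncomputable section

namespace Localization

/-- The plane in which the nodes live. -/
abbrev Plane := EuclideanSpace ℝ (Fin 2)

/-! ### One received waveform -/

/-- The data common to all transmissions: the known (real) transmitted waveform `s`, the propagation
speed `c`, the noise level (two-sided power spectral density `N₀ / 2`), and the length of the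
observation interval `[0, Tob)`. -/
structure SignalModel where
  s : ℝ → ℝ
  smooth : ContDiff ℝ 1 s
  c : ℝ
  c_pos : 0 < c
  N₀ : ℝ
  N₀_pos : 0 < N₀
  Tob : ℝ
  Tob_pos : 0 < Tob

/-- A multipath channel: `L` paths with amplitudes and nonnegative range biases. In line of sight
the first path has the bias `0`, and this is known to the receiver. The channel with `L = 0` is that
of a pair of nodes that do not communicate. -/
structure Channel where
  L : ℕ
  los : Bool
  amp : Fin L → ℝ
  bias : Fin L → ℝ
  bias_nonneg : ∀ l, 0 ≤ bias l
  bias_los : ∀ l : Fin L, los = true → l.val = 0 → bias l = 0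

/-- The indices of the unknown multipath parameters of a channel: all amplitudes, and all range
biases except the one that is known to vanish in line of sight. -/
abbrev Channel.Param (h : Channel) : Type :=
  Fin h.L ⊕ {l : Fin h.L // ¬ (h.los = true ∧ l.val = 0)}

instance (h : Channel) : Fintype h.Param := inferInstance

instance (h : Channel) : DecidableEq h.Param := inferInstance

namespace SignalModel

variable (M : SignalModel)

/-- The noiseless received waveform `∑ₗ αₗ s(t - τₗ)`, with delays `τₗ = (d + bₗ) / c`. -/
def received {L : ℕ} (d : ℝ) (amp bias : Fin L → ℝ) (t : ℝ) : ℝ :=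
  ∑ l, amp l * M.s (t - (d + bias l) / M.c)

/-- The partial derivatives of the noiseless received waveform with respect to the distance `d` of
the two nodes and to the unknown multipath parameters. -/
def sensitivity (h : Channel) (d : ℝ) : Unit ⊕ h.Param → ℝ → ℝ
  | Sum.inl _, t => deriv (fun x => M.received x h.amp h.bias t) d
  | Sum.inr (Sum.inl l), t =>
      deriv (fun x => M.received d (Function.update h.amp l x) h.bias t) (h.amp l)
  | Sum.inr (Sum.inr l), t =>
      deriv (fun x => M.received d h.amp (Function.update h.bias l.1 x) t) (h.bias l.1)

/-- The Fisher information matrix, for the distance and the unknown multipath parameters, of the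
waveform received in white Gaussian noise of two-sided power spectral density `N₀ / 2`. -/
def linkFIM (h : Channel) (d : ℝ) : Matrix (Unit ⊕ h.Param) (Unit ⊕ h.Param) ℝ :=
  Matrix.of fun i j =>
    2 / M.N₀ * ∫ t in (0 : ℝ)..M.Tob, M.sensitivity h d i t * M.sensitivity h d j t

end SignalModel

/-- The equivalent Fisher information matrix for the first group of parameters
(the Schur complement). -/
def efim {m n : Type*} [Fintype n] [DecidableEq n] (J : Matrix (m ⊕ n) (m ⊕ n) ℝ) :
    Matrix m m ℝ :=
  J.toBlocks₁₁ - J.toBlocks₁₂ * J.toBlocks₂₂⁻¹ * J.toBlocks₂₁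

/-- The ranging information intensity of a received waveform: the equivalent Fisher information for
the distance of the two nodes. -/
def SignalModel.rii (M : SignalModel) (h : Channel) (d : ℝ) : ℝ :=
  efim (M.linkFIM h d) () ()

/-! ### The network -/

section Network

variable {A B : Type} [Fintype A] [Fintype B] [DecidableEq A] [DecidableEq B]

/-- The received waveforms of a network with agents `A` and anchors `B`: agent `k` receives from
every anchor and from every other agent. -/
abbrev Link (A B : Type) : Type := {l : A × (A ⊕ B) // l.2 ≠ Sum.inl l.1}

/-- The distance between the receiving agent and the transmitting node. -/
def linkDist (pos : A ⊕ B → Plane) (l : Link A B) : ℝ :=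
  dist (pos (Sum.inl l.1.1)) (pos l.1.2)

/-- The unit vector `q` on the line through the two nodes; it is the gradient of their distance
with respect to the position of the receiving agent. -/
def linkDir (pos : A ⊕ B → Plane) (l : Link A B) : Plane :=
  (linkDist pos l)⁻¹ • (pos (Sum.inl l.1.1) - pos l.1.2)

/-- The indices of the unknown parameter vector `θ`: the coordinates of the positions of all agents,
and the unknown multipath parameters of all received waveforms. -/
abbrev Param (chan : Link A B → Channel) : Type :=
  (A × Fin 2) ⊕ (Σ l : Link A B, (chan l).Param)

instance (chan : Link A B → Channel) : Fintype (Param chan) := inferInstance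

instance (chan : Link A B → Channel) : DecidableEq (Param chan) := inferInstance

/-- The Jacobian matrix of the distance and the multipath parameters of the link `l`, as functions
of the parameter vector `θ`. -/
def linkJacobian (pos : A ⊕ B → Plane) (chan : Link A B → Channel) (l : Link A B) :
    Matrix (Unit ⊕ (chan l).Param) (Param chan) ℝ :=
  Matrix.of fun
    | Sum.inl _, Sum.inl (a, i) =>
        (if a = l.1.1 then linkDir pos l i else 0) - (if Sum.inl a = l.1.2 then linkDir pos l i else 0)
    | Sum.inl _, Sum.inr _ => 0
    | Sum.inr _, Sum.inl _ => 0
    | Sum.inr x, Sum.inr y => if (⟨l, x⟩ : Σ l : Link A B, (chan l).Param) = y then 1 else 0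

/-- The Fisher information matrix `J_θ` of the whole parameter vector: the received waveforms are
independent, so that their informations add up, and each depends on the positions through the
distance only. No prior knowledge is available. -/
def fim (M : SignalModel) (pos : A ⊕ B → Plane) (chan : Link A B → Channel) :
    Matrix (Param chan) (Param chan) ℝ :=
  ∑ l : Link A B, (linkJacobian pos chan l).transpose * M.linkFIM (chan l) (linkDist pos l) *
    linkJacobian pos chan l

/-- The squared position error bound of agent `k` in cooperative localization: the trace of the
`2 × 2` block of `J_θ⁻¹` that belongs to the position of agent `k`.
(If `J_θ` is singular, Lean's value is `0`.) -/
def speb (M : SignalModel) (pos : A ⊕ B → Plane) (chan : Link A B → Channel) (k : A) : ℝ :=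
  ∑ i : Fin 2, (fim M pos chan)⁻¹ (Sum.inl (k, i)) (Sum.inl (k, i))

/-- The waveform that agent `k` receives from anchor `j`, among all received waveforms. -/
def soloLink (k : A) (l : Link Unit B) : Link A B :=
  ⟨(k, Sum.map (fun _ => k) id l.1.2), by
    obtain ⟨⟨u, j⟩, hj⟩ := l
    cases j with
    | inl v => exact absurd rfl hj
    | inr j => simp⟩

/-- The squared position error bound of agent `k` in non-cooperative localization: agent `k` uses
only the waveforms it receives from the anchors, so that it is the only agent of its network. -/
def spebNoncoop (M : SignalModel) (pos : A ⊕ B → Plane) (chan : Link A B → Channel) (k : A) : ℝ :=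
  speb M (pos ∘ Sum.map (fun _ : Unit => k) id) (chan ∘ soloLink k) ()

end Network

/-! ### Random dense networks -/

/-- A random network with `Na` agents and `Nb` anchors in the fixed area `S`:
the positions of all nodes are independent and uniform in `S`, the fading variables `Z` of the
received waveforms are i.i.d. with law `ζ` and independent of the positions, the unknown multipath
parameters of each waveform are identifiable (nonsingular Fisher information), and the ranging
information intensity of a waveform received over the distance `d` is `Z / d ^ (2 b)`, where `b` is
the amplitude loss exponent, if `d` is at least the minimum distance `r₀`, and `0` otherwise. -/
structure IsDenseNetwork (M : SignalModel) (S : Set Plane) (r₀ b : ℝ) (ζ : Measure ℝ)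
    {Na Nb : ℕ} {Ω : Type*} [MeasurableSpace Ω] (P : Measure Ω)
    (pos : Ω → Fin Na ⊕ Fin Nb → Plane) (Z : Ω → Link (Fin Na) (Fin Nb) → ℝ)
    (chan : Ω → Link (Fin Na) (Fin Nb) → Channel) : Prop where
  law : HasLaw (fun ω => (pos ω, Z ω))
    ((Measure.pi fun _ => cond volume S).prod (Measure.pi fun _ => ζ)) P
  identifiable : ∀ᵐ ω ∂P, ∀ l,
    (M.linkFIM (chan ω l) (linkDist (pos ω) l)).toBlocks₂₂.PosDef
  rii_eq : ∀ᵐ ω ∂P, ∀ l, M.rii (chan ω l) (linkDist (pos ω) l) =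
    if r₀ ≤ linkDist (pos ω) l then Z ω l / linkDist (pos ω) l ^ (2 * b) else 0

end Localization

end

universe u

/-! Completing the square in the multipath parameters of each waveform leaves the quadratic form
`rangeForm` in the displacement `x` of the agents: the sum over the links of the ranging intensity
times the squared rate of change of the length, with anchors at rest. A diagonal entry of the
inverse of a positive definite matrix is the reciprocal of the least value of its form on vectors
with that coordinate equal to `1`. Two-sided bounds for the error thus reduce to two-sided bounds
for `rangeForm`.

The lower bound for the error (`le_speb`) is the easy one: intensities are at most `Λ = z₁ / r₀ ^ (2
* b)`, and moving one agent alone affects at most twice as many links as there are nodes.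

For the upper bound, given the position of a node, the gains of the `n` links it receives are i.i.d.
Their mean is bounded below uniformly in position and direction, by compactness, since no disc of
radius `r₀` covers `S` and lines are null. Chernoff's bound (`measure_sum_linkGain_le`) makes the
sum of order `n` outside an event of probability `exp (-(η / 4 * n))`, and a finite net of the unit
circle handles all directions at once. The anchors alone then settle the non-cooperative case.

In cooperation the neighbours of an agent are unknown as well. A neighbour well localized by anchors
pays `Λ * ‖x j‖ ^ 2`, which turns its link into half the information that a transmitter at rest
would give (`le_rangeForm`). A union bound over agents that are badly localized by anchors would not
be uniform in `Na`; Markov's inequality shows instead that their proportion is small, and their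
links are discarded. Every agent must still have large total gain, since otherwise `J_θ` could be
singular, but there the union bound works: `Na * exp (-(η / 4 * (Nb + Na - 1)))` is small uniformly
in `Na`. -/

/-! ### Diagonal entries of the inverse of a positive definite matrix -/

open Matrix in
theorem Matrix.PosDef.inv_diag_le_of_le {n : Type*} [Fintype n] [DecidableEq n] {A : Matrix n n ℝ}
    (hA : A.PosDef) {a : n} {m : ℝ} (hm : 0 < m) (h : ∀ x : n → ℝ, m * x a ^ 2 ≤ x ⬝ᵥ (A *ᵥ x)) :
    A⁻¹ a a ≤ 1 / m := by
  have hdet : IsUnit A.det := (Matrix.isUnit_iff_isUnit_det _).1 hA.isUnit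
  -- On the column `a` of `A⁻¹` the hypothesis reads `m * g ^ 2 ≤ g`, with `g = A⁻¹ a a`.
  have h1 := h (A⁻¹ *ᵥ Pi.single a 1)
  rw [Matrix.mulVec_mulVec, Matrix.mul_nonsing_inv _ hdet, Matrix.one_mulVec,
    dotProduct_single_one, Matrix.mulVec_single_one] at h1
  simp only [Matrix.col_apply] at h1
  have h2 : 0 < A⁻¹ a a := hA.inv.diag_pos
  rw [le_div_iff₀ hm]
  by_contra! hc
  nlinarith

-- The minimizer of the form under `x a = 1` is the column `a` of `A⁻¹` divided by `A⁻¹ a a`.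
-- Expanding the form at the difference of `x` and this minimizer shows that `x` exceeds the minimum
-- `(A⁻¹ a a)⁻¹` by a nonnegative amount.
open Matrix in
theorem Matrix.PosDef.le_inv_diag {n : Type*} [Fintype n] [DecidableEq n] {A : Matrix n n ℝ}
    (hA : A.PosDef) {a : n} {x : n → ℝ} (hx : x a = 1) {m : ℝ} (h : x ⬝ᵥ (A *ᵥ x) ≤ m) :
    1 / m ≤ A⁻¹ a a := by
  have hdet : IsUnit A.det := (Matrix.isUnit_iff_isUnit_det _).1 hA.isUnit
  have h2 : 0 < A⁻¹ a a := hA.inv.diag_pos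
  set g := A⁻¹ a a
  set y := A⁻¹ *ᵥ Pi.single a 1 with hy
  have hAy : A *ᵥ y = Pi.single a 1 := by
    rw [hy, Matrix.mulVec_mulVec, Matrix.mul_nonsing_inv _ hdet, Matrix.one_mulVec]
  have hyA : y ᵥ* A = Pi.single a 1 := by
    have ht : Aᵀ = A := by simpa using hA.isHermitian.eq
    rw [← Matrix.mulVec_transpose, ht, hAy]
  have hya : y a = g := by
    rw [hy, Matrix.mulVec_single_one]; rfl
  have h0 := hA.posSemidef.dotProduct_mulVec_nonneg (x - g⁻¹ • y)
  have e : star (x - g⁻¹ • y) ⬝ᵥ (A *ᵥ (x - g⁻¹ • y)) = x ⬝ᵥ (A *ᵥ x) - g⁻¹ := by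
    rw [star_trivial, Matrix.mulVec_sub, Matrix.mulVec_smul, hAy, sub_dotProduct, dotProduct_sub,
      dotProduct_sub, smul_dotProduct, smul_dotProduct, dotProduct_mulVec y, hyA]
    simp [hx, hya]
    field_simp
    ring
  rw [e] at h0
  rw [one_div]
  exact inv_le_of_inv_le₀ h2 (by linarith)

/-! ### Elimination of the multipath parameters, and the error bound in terms of `rangeForm` -/

namespace Localization

open Matrix in
/-- Completion of the square: the form of a matrix in terms of its Schur complement. -/
theorem dotProduct_mulVec_eq_efim {n : Type*} [Fintype n] [DecidableEq n]
    {L : Matrix (Unit ⊕ n) (Unit ⊕ n) ℝ} (hL : Lᵀ = L) (hD : L.toBlocks₂₂.PosDef)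
    (d : ℝ) (y : n → ℝ) :
    Sum.elim (fun _ => d) y ⬝ᵥ (L *ᵥ Sum.elim (fun _ => d) y) =
      efim L () () * d ^ 2 + (d • (fun i => (L.toBlocks₂₂⁻¹ * L.toBlocks₂₁) i ()) + y) ⬝ᵥ
        (L.toBlocks₂₂ *ᵥ (d • (fun i => (L.toBlocks₂₂⁻¹ * L.toBlocks₂₁) i ()) + y)) := by
  have : Invertible L.toBlocks₂₂ := hD.isUnit.invertible
  have h12 : L.toBlocks₂₁ = L.toBlocks₁₂ᴴ := by
    ext i j
    exact (congrFun (congrFun hL (Sum.inl j)) (Sum.inr i))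
  have hfb : L = fromBlocks L.toBlocks₁₁ L.toBlocks₁₂ L.toBlocks₁₂ᴴ L.toBlocks₂₂ := by
    rw [← h12, fromBlocks_toBlocks]
  have key := schur_complement_eq₂₂ (A := L.toBlocks₁₁) L.toBlocks₁₂ (D := L.toBlocks₂₂)
    (fun _ : Unit => d) y hD.isHermitian
  rw [← hfb, star_trivial, ← dotProduct_mulVec] at key
  rw [key, efim, h12]
  have e1 : (L.toBlocks₂₂⁻¹ * L.toBlocks₁₂ᴴ) *ᵥ (fun _ : Unit => d) =
      d • (fun i => (L.toBlocks₂₂⁻¹ * L.toBlocks₁₂ᴴ) i ()) := by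
    ext i; simp [mulVec, dotProduct, mul_comm]
  rw [e1, ← dotProduct_mulVec, star_trivial, add_comm]
  congr 1
  simp [vecMul, dotProduct]
  ring

theorem SignalModel.linkFIM_transpose (M : SignalModel) (h : Channel) (d : ℝ) :
    (M.linkFIM h d).transpose = M.linkFIM h d := by
  ext i j
  simp only [Matrix.transpose_apply, SignalModel.linkFIM, Matrix.of_apply, mul_comm]

section Network

variable {A B : Type} [Fintype A] [Fintype B] [DecidableEq A] [DecidableEq B]

/-- The rate of change of the length of a link under a displacement `x` of the agents. -/
noncomputable def rangeRate (pos : A ⊕ B → Plane) (l : Link A B) (x : A → Plane) : ℝ :=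
  inner ℝ (linkDir pos l) (x l.1.1 - Sum.elim x 0 l.1.2)

/-- The position part of a perturbation of the parameter vector. -/
noncomputable def displacement {chan : Link A B → Channel} (θ : Param chan → ℝ) (a : A) : Plane :=
  WithLp.toLp 2 fun i => θ (Sum.inl (a, i))

omit [Fintype B] [DecidableEq B] [Fintype A] in
theorem sum_ite_linkDir_mul [Fintype A] (pos : A ⊕ B → Plane) (l : Link A B) (u : A → Plane) :
    ∑ a, ∑ i, (if a = l.1.1 then linkDir pos l i else 0) * u a i =
      inner ℝ (linkDir pos l) (u l.1.1) := by
  rw [Finset.sum_eq_single l.1.1]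
  · simp [PiLp.inner_apply, mul_comm]
  · intro a _ ha; simp [ha]
  · simp

theorem linkJacobian_mulVec (pos : A ⊕ B → Plane) (chan : Link A B → Channel) (l : Link A B)
    (θ : Param chan → ℝ) :
    Matrix.mulVec (linkJacobian pos chan l) θ =
      Sum.elim (fun _ => rangeRate pos l (displacement θ)) fun y => θ (Sum.inr ⟨l, y⟩) := by
  ext (_ | x)
  · simp only [Matrix.mulVec, dotProduct, Fintype.sum_sum_type, linkJacobian, Matrix.of_apply,
      zero_mul, Finset.sum_const_zero, add_zero, Sum.elim_inl, rangeRate, inner_sub_right,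
      Fintype.sum_prod_type, sub_mul, Finset.sum_sub_distrib]
    congr 1
    · exact sum_ite_linkDir_mul pos l (displacement θ)
    · obtain ⟨⟨k, j⟩, hj⟩ := l
      rcases j with j | j
      · simp only [Sum.inl.injEq, Sum.elim_inl]
        rw [Finset.sum_eq_single j]
        · simp [PiLp.inner_apply, mul_comm, displacement]
        · intro a _ ha; simp [ha]
        · simp
      · simp
  · simp [Matrix.mulVec, dotProduct, linkJacobian, Fintype.sum_sum_type]

open Matrix in
theorem dotProduct_fim_mulVec (M : SignalModel) (pos : A ⊕ B → Plane) (chan : Link A B → Channel)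
    (θ : Param chan → ℝ) :
    θ ⬝ᵥ (fim M pos chan *ᵥ θ) = ∑ l,
      Sum.elim (fun _ => rangeRate pos l (displacement θ)) (fun y => θ (Sum.inr ⟨l, y⟩)) ⬝ᵥ
        (M.linkFIM (chan l) (linkDist pos l) *ᵥ
          Sum.elim (fun _ => rangeRate pos l (displacement θ)) (fun y => θ (Sum.inr ⟨l, y⟩))) := by
  rw [fim, Matrix.sum_mulVec, dotProduct_sum]
  refine Finset.sum_congr rfl fun l _ => ?_
  rw [← linkJacobian_mulVec, ← Matrix.mulVec_mulVec, ← Matrix.mulVec_mulVec,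
    Matrix.dotProduct_mulVec, Matrix.vecMul_transpose]

theorem fim_transpose (M : SignalModel) (pos : A ⊕ B → Plane) (chan : Link A B → Channel) :
    (fim M pos chan).transpose = fim M pos chan := by
  rw [fim, Matrix.transpose_sum]
  refine Finset.sum_congr rfl fun l _ => ?_
  rw [Matrix.transpose_mul, Matrix.transpose_mul, Matrix.transpose_transpose,
    SignalModel.linkFIM_transpose, Matrix.mul_assoc]

/-- The information of the network about a displacement of its agents, the multipath parameters
having been eliminated. -/
noncomputable def rangeForm (M : SignalModel) (pos : A ⊕ B → Plane) (chan : Link A B → Channel)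
    (x : A → Plane) : ℝ :=
  ∑ l, M.rii (chan l) (linkDist pos l) * rangeRate pos l x ^ 2

-- On each link the completed square in the multipath parameters is nonnegative and may be dropped.
open Matrix in
theorem rangeForm_le (M : SignalModel) (pos : A ⊕ B → Plane) (chan : Link A B → Channel)
    (hD : ∀ l, (M.linkFIM (chan l) (linkDist pos l)).toBlocks₂₂.PosDef) (θ : Param chan → ℝ) :
    rangeForm M pos chan (displacement θ) ≤ θ ⬝ᵥ (fim M pos chan *ᵥ θ) := by
  rw [dotProduct_fim_mulVec]
  refine Finset.sum_le_sum fun l _ => ?_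
  rw [dotProduct_mulVec_eq_efim (M.linkFIM_transpose _ _) (hD l)]
  refine le_add_of_nonneg_right ?_
  have := (hD l).posSemidef.dotProduct_mulVec_nonneg
  simp only [star_trivial] at this
  exact this _

/-- Some choice of the multipath parameters leaves no more information than `rangeForm`. -/
theorem exists_fim_eq_rangeForm (M : SignalModel) (pos : A ⊕ B → Plane)
    (chan : Link A B → Channel)
    (hD : ∀ l, (M.linkFIM (chan l) (linkDist pos l)).toBlocks₂₂.PosDef) (x : A → Plane) :
    ∃ θ : Param chan → ℝ, displacement θ = x ∧
      dotProduct θ (Matrix.mulVec (fim M pos chan) θ) = rangeForm M pos chan x := by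
  classical
  -- The multipath components are the ones for which every completed square vanishes.
  let θ : Param chan → ℝ := Sum.elim (fun p => x p.1 p.2) fun p =>
    - (rangeRate pos p.1 x *
      ((M.linkFIM (chan p.1) (linkDist pos p.1)).toBlocks₂₂⁻¹ *
        (M.linkFIM (chan p.1) (linkDist pos p.1)).toBlocks₂₁) p.2 ())
  have hx : displacement θ = x := rfl
  refine ⟨θ, hx, ?_⟩
  rw [dotProduct_fim_mulVec]
  refine Finset.sum_congr rfl fun l _ => ?_
  rw [dotProduct_mulVec_eq_efim (M.linkFIM_transpose _ _) (hD l), hx]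
  have h0 : (rangeRate pos l x • (fun i => ((M.linkFIM (chan l) (linkDist pos l)).toBlocks₂₂⁻¹ *
      (M.linkFIM (chan l) (linkDist pos l)).toBlocks₂₁) i ()) + fun y => θ (Sum.inr ⟨l, y⟩)) = 0 := by
    ext y; simp [θ]
  rw [h0]
  simp [SignalModel.rii]

/-- If the ranging information controls the displacement of every agent, no parameter is left
undetermined. -/
theorem posDef_fim (M : SignalModel) (pos : A ⊕ B → Plane) (chan : Link A B → Channel)
    (hD : ∀ l, (M.linkFIM (chan l) (linkDist pos l)).toBlocks₂₂.PosDef) {m : ℝ} (hm : 0 < m)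
    (h : ∀ (x : A → Plane) (a : A), m * ‖x a‖ ^ 2 ≤ rangeForm M pos chan x) :
    (fim M pos chan).PosDef := by
  refine Matrix.PosDef.of_dotProduct_mulVec_pos (fim_transpose M pos chan) ?_
  intro θ hθ
  rw [star_trivial]
  have hle := rangeForm_le M pos chan hD θ
  -- If no agent moves, only the positive definite multipath blocks contribute, and one of them sees
  -- a nonzero vector. Otherwise `rangeForm` is already positive.
  by_cases h0 : ∀ a, displacement θ a = 0
  · have hx : displacement θ = 0 := funext h0
    rw [dotProduct_fim_mulVec, hx]
    have hr : ∀ l, rangeRate pos l (0 : A → Plane) = 0 := by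
      intro l
      rcases hl : l.1.2 with j | j <;> simp [rangeRate, hl]
    have hl : ∃ l, (fun y => θ (Sum.inr ⟨l, y⟩)) ≠ 0 := by
      by_contra! hc
      apply hθ
      ext (⟨a, i⟩ | ⟨l, y⟩)
      · exact congrArg (fun v : Plane => v i) (h0 a)
      · exact congrFun (hc l) y
    obtain ⟨l, hl⟩ := hl
    have e : ∀ l, dotProduct (Sum.elim (fun _ => rangeRate pos l 0) fun y => θ (Sum.inr ⟨l, y⟩))
        (Matrix.mulVec (M.linkFIM (chan l) (linkDist pos l))
          (Sum.elim (fun _ => rangeRate pos l 0) fun y => θ (Sum.inr ⟨l, y⟩))) =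
        dotProduct (fun y => θ (Sum.inr ⟨l, y⟩))
          (Matrix.mulVec (M.linkFIM (chan l) (linkDist pos l)).toBlocks₂₂
            (fun y => θ (Sum.inr ⟨l, y⟩))) := by
      intro l
      rw [dotProduct_mulVec_eq_efim (M.linkFIM_transpose _ _) (hD l), hr l]
      simp
    simp only [e]
    refine Finset.sum_pos' (fun l _ => ?_) ⟨l, Finset.mem_univ _, ?_⟩
    · simpa using (hD l).posSemidef.dotProduct_mulVec_nonneg _
    · simpa using (hD l).dotProduct_mulVec_pos hl
  · push Not at h0
    obtain ⟨a, ha⟩ := h0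
    have := h (displacement θ) a
    have : 0 < m * ‖displacement θ a‖ ^ 2 := by positivity
    linarith

theorem speb_le (M : SignalModel) (pos : A ⊕ B → Plane) (chan : Link A B → Channel)
    (hD : ∀ l, (M.linkFIM (chan l) (linkDist pos l)).toBlocks₂₂.PosDef) {m : ℝ} (hm : 0 < m)
    (h : ∀ (x : A → Plane) (a : A), m * ‖x a‖ ^ 2 ≤ rangeForm M pos chan x) (k : A) :
    speb M pos chan k ≤ 2 / m := by
  have key : ∀ i : Fin 2, (fim M pos chan)⁻¹ (Sum.inl (k, i)) (Sum.inl (k, i)) ≤ 1 / m := by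
    intro i
    refine (posDef_fim M pos chan hD hm h).inv_diag_le_of_le hm fun θ => ?_
    refine le_trans ?_ ((h (displacement θ) k).trans (rangeForm_le M pos chan hD θ))
    have h1 : |θ (Sum.inl (k, i))| ≤ ‖displacement θ k‖ := PiLp.norm_apply_le (displacement θ k) i
    have := sq_le_sq' (by linarith [abs_nonneg (θ (Sum.inl (k, i))), norm_nonneg (displacement θ k)]) h1
    rw [sq_abs] at this
    gcongr
  rw [speb, Fin.sum_univ_two]
  have := key 0
  have := key 1
  have e : 2 / m = 1 / m + 1 / m := by ring
  linarith

omit [Fintype A] [Fintype B] [DecidableEq A] [DecidableEq B] in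
theorem norm_linkDir_le (pos : A ⊕ B → Plane) (l : Link A B) : ‖linkDir pos l‖ ≤ 1 := by
  rw [linkDir, norm_smul, norm_inv, Real.norm_eq_abs, linkDist, abs_of_nonneg dist_nonneg,
    ← dist_eq_norm]
  exact inv_mul_le_one

/-- At most twice the number of nodes are involved in links with a given agent. -/
theorem card_links_le (k : A) :
    (Finset.univ.filter fun l : Link A B => l.1.1 = k ∨ l.1.2 = Sum.inl k).card ≤
      2 * (Fintype.card B + Fintype.card A) := by
  have h1 : (Finset.univ.filter fun l : Link A B => l.1.1 = k).card ≤
      Fintype.card B + Fintype.card A := by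
    have := Finset.card_le_card_of_injOn (s := Finset.univ.filter fun l : Link A B => l.1.1 = k)
      (t := (Finset.univ : Finset (A ⊕ B))) (fun l => l.1.2) (fun _ _ => Finset.mem_coe.2 (Finset.mem_univ _)) (by
        intro l hl l' hl' h
        simp only [Finset.coe_filter, Finset.mem_univ, true_and, Set.mem_ofPred_eq] at hl hl'
        exact Subtype.ext (Prod.ext (hl.trans hl'.symm) h))
    simpa [add_comm] using this
  have h2 : (Finset.univ.filter fun l : Link A B => l.1.2 = Sum.inl k).card ≤ Fintype.card A := by
    have := Finset.card_le_card_of_injOn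
      (s := Finset.univ.filter fun l : Link A B => l.1.2 = Sum.inl k)
      (t := (Finset.univ : Finset A)) (fun l => l.1.1) (fun _ _ => Finset.mem_coe.2 (Finset.mem_univ _)) (by
        intro l hl l' hl' h
        simp only [Finset.coe_filter, Finset.mem_univ, true_and, Set.mem_ofPred_eq] at hl hl'
        exact Subtype.ext (Prod.ext h (hl.trans hl'.symm)))
    simpa using this
  rw [Finset.filter_or]
  refine (Finset.card_union_le _ _).trans ?_
  omega

/-- The test vector moves agent `k` alone by a unit coordinate vector, with the least informative
multipath parameters. Only links at `k` change, each at rate at most `1`. The hypothesis `hF`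
matters: for a singular matrix the value of `speb` would be `0`. -/
theorem le_speb (M : SignalModel) (pos : A ⊕ B → Plane) (chan : Link A B → Channel)
    (hD : ∀ l, (M.linkFIM (chan l) (linkDist pos l)).toBlocks₂₂.PosDef)
    (hF : (fim M pos chan).PosDef) {Λ : ℝ} (hΛ : ∀ l, M.rii (chan l) (linkDist pos l) ≤ Λ)
    (hΛ0 : 0 ≤ Λ) (k : A) :
    1 / (Λ * ((Fintype.card B : ℝ) + Fintype.card A)) ≤ speb M pos chan k := by
  have key : ∀ i : Fin 2, 1 / (2 * (Λ * ((Fintype.card B : ℝ) + Fintype.card A))) ≤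
      (fim M pos chan)⁻¹ (Sum.inl (k, i)) (Sum.inl (k, i)) := by
    intro i
    obtain ⟨θ, hθ, h⟩ := exists_fim_eq_rangeForm M pos chan hD
      (Pi.single k (EuclideanSpace.single i 1))
    have h1 : θ (Sum.inl (k, i)) = 1 := by
      have := congrArg (fun x : A → Plane => x k i) hθ
      simpa [displacement] using this
    refine hF.le_inv_diag h1 ?_
    rw [h, rangeForm, ← Finset.sum_filter_add_sum_filter_not Finset.univ
      fun l : Link A B => l.1.1 = k ∨ l.1.2 = Sum.inl k]
    rw [Finset.sum_eq_zero (s := Finset.univ.filter fun l : Link A B =>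
      ¬ (l.1.1 = k ∨ l.1.2 = Sum.inl k)), add_zero]
    · have : ∀ l ∈ Finset.univ.filter fun l : Link A B => l.1.1 = k ∨ l.1.2 = Sum.inl k,
          M.rii (chan l) (linkDist pos l) *
            rangeRate pos l (Pi.single k (EuclideanSpace.single i 1)) ^ 2 ≤ Λ := by
        intro l hl
        have hr : |rangeRate pos l (Pi.single k (EuclideanSpace.single i (1 : ℝ)))| ≤ 1 := by
          refine (abs_real_inner_le_norm _ _).trans ?_
          refine mul_le_one₀ (norm_linkDir_le pos l) (norm_nonneg _) ?_
          obtain ⟨⟨a, j⟩, hj⟩ := l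
          by_cases ha : a = k
          · subst ha
            rcases j with j | j
            · have hja : j ≠ a := fun e => hj (by rw [e])
              simp [hja]
            · simp
          · simp only [Finset.mem_filter, Finset.mem_univ, true_and, ha, false_or] at hl
            subst hl
            simp [ha]
        have hr2 : rangeRate pos l (Pi.single k (EuclideanSpace.single i (1 : ℝ))) ^ 2 ≤ 1 := by
          rw [sq_le_one_iff_abs_le_one]; exact hr
        calc _ ≤ Λ * rangeRate pos l (Pi.single k (EuclideanSpace.single i (1 : ℝ))) ^ 2 := by
              gcongr; exact hΛ l
          _ ≤ Λ * 1 := by gcongr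
          _ = Λ := mul_one _
      refine (Finset.sum_le_card_nsmul _ _ _ this).trans ?_
      rw [nsmul_eq_mul]
      have hc : ((Finset.univ.filter fun l : Link A B => l.1.1 = k ∨ l.1.2 = Sum.inl k).card : ℝ) ≤
          2 * (Fintype.card B + Fintype.card A) := by exact_mod_cast card_links_le k
      calc _ ≤ 2 * ((Fintype.card B : ℝ) + Fintype.card A) * Λ := by gcongr
        _ = _ := by ring
    · intro l hl
      simp only [Finset.mem_filter, Finset.mem_univ, true_and, not_or] at hl
      have : rangeRate pos l (Pi.single k (EuclideanSpace.single i (1 : ℝ))) = 0 := by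
        rcases hj : l.1.2 with j | j
        · have : j ≠ k := fun e => hl.2 (by rw [hj, e])
          simp [rangeRate, hl.1, hj, this]
        · simp [rangeRate, hl.1, hj]
      rw [this]; ring
  rw [speb, Fin.sum_univ_two]
  have := key 0
  have := key 1
  have e : 1 / (Λ * ((Fintype.card B : ℝ) + Fintype.card A)) =
    1 / (2 * (Λ * ((Fintype.card B : ℝ) + Fintype.card A))) +
    1 / (2 * (Λ * ((Fintype.card B : ℝ) + Fintype.card A))) := by
    rw [← add_div, one_add_one_eq_two, div_mul_eq_div_div (2 : ℝ) 2, div_self two_ne_zero]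
  linarith

end Network
end Localization

/-! ### Deterministic lower bounds for `rangeForm` -/

namespace Localization

/-- A form that is large on a net of the unit circle is large everywhere. -/
theorem le_sum_inner_sq_of_net {ι : Type*} [Fintype ι] {lam : ι → ℝ} {q : ι → Plane} {Λ : ℝ}
    (h0 : ∀ n, 0 ≤ lam n) (hΛ : ∀ n, lam n ≤ Λ) (hΛ0 : 0 ≤ Λ) (hq : ∀ n, ‖q n‖ ≤ 1)
    {T : Finset Plane} {δ c : ℝ} (hT : ∀ u : Plane, ‖u‖ = 1 → ∃ v ∈ T, ‖u - v‖ ≤ δ)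
    (hδ : Λ * δ ^ 2 ≤ c / 4)
    (h : ∀ v ∈ T, c * Fintype.card ι ≤ ∑ n, lam n * inner ℝ (q n) v ^ 2) (u : Plane) :
    c / 4 * Fintype.card ι * ‖u‖ ^ 2 ≤ ∑ n, lam n * inner ℝ (q n) u ^ 2 := by
  have unit : ∀ u : Plane, ‖u‖ = 1 →
      c / 4 * Fintype.card ι ≤ ∑ n, lam n * inner ℝ (q n) u ^ 2 := by
    intro u hu
    obtain ⟨v, hv, huv⟩ := hT u hu
    have h1 : ∀ n, lam n * inner ℝ (q n) v ^ 2 / 2 - c / 4 ≤ lam n * inner ℝ (q n) u ^ 2 := by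
      intro n
      have e : (inner ℝ (q n) v : ℝ) = inner ℝ (q n) u - inner ℝ (q n) (u - v) := by
        rw [inner_sub_right]; ring
      have hb : |(inner ℝ (q n) (u - v) : ℝ)| ≤ δ :=
        (abs_real_inner_le_norm _ _).trans
          ((mul_le_of_le_one_left (norm_nonneg _) (hq n)).trans huv)
      have hb2 : (inner ℝ (q n) (u - v) : ℝ) ^ 2 ≤ δ ^ 2 := by
        rw [← sq_abs]; gcongr
      have hb3 : lam n * (inner ℝ (q n) (u - v) : ℝ) ^ 2 ≤ c / 4 :=
        (mul_le_mul (hΛ n) hb2 (sq_nonneg _) hΛ0).trans hδ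
      rw [e]
      -- This is `(s - t) ^ 2 ≤ 2 * s ^ 2 + 2 * t ^ 2`, the error term being at most `c / 4`.
      nlinarith [mul_nonneg (h0 n) (sq_nonneg ((inner ℝ (q n) u : ℝ) + inner ℝ (q n) (u - v)))]
    have h2 := Finset.sum_le_sum fun n (_ : n ∈ Finset.univ) => h1 n
    rw [Finset.sum_sub_distrib, ← Finset.sum_div, Finset.sum_const, nsmul_eq_mul,
      Finset.card_univ] at h2
    linarith [h v hv]
  rcases eq_or_ne u 0 with rfl | hu
  · simp
  have hn : 0 < ‖u‖ := norm_pos_iff.2 hu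
  have h3 := unit (‖u‖⁻¹ • u) (by rw [norm_smul, norm_inv, norm_norm, inv_mul_cancel₀ hn.ne'])
  have e : ∀ n, lam n * inner ℝ (q n) u ^ 2 =
      ‖u‖ ^ 2 * (lam n * inner ℝ (q n) (‖u‖⁻¹ • u) ^ 2) := by
    intro n
    rw [inner_smul_right]
    field_simp
  simp only [e]
  rw [← Finset.mul_sum, mul_comm]
  gcongr

section Network

variable {A B : Type} [Fintype A] [Fintype B] [DecidableEq A] [DecidableEq B]

/-- The waveform that agent `i` receives from another node. -/
def linkTo (i : A) (n : {n : A ⊕ B // n ≠ Sum.inl i}) : Link A B := ⟨(i, n.1), n.2⟩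

/-- The waveform that agent `i` receives from an anchor. -/
def anchorLink (i : A) (j : B) : Link A B := ⟨(i, Sum.inr j), Sum.inr_ne_inl⟩

theorem sum_link (f : Link A B → ℝ) : ∑ l, f l = ∑ i, ∑ n, f (linkTo i n) := by
  rw [← Fintype.sum_sigma']
  exact Fintype.sum_equiv
    { toFun := fun l => ⟨l.1.1, l.1.2, l.2⟩
      invFun := fun p => linkTo p.1 p.2
      left_inv := fun _ => rfl
      right_inv := fun _ => rfl } _ _ fun _ => rfl

/-- The star-shaped part of the network consisting of the waveforms received by agent `i`, and by
its well localized neighbours from the anchors, determines the position of agent `i`. -/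
theorem le_rangeForm (M : SignalModel) (pos : A ⊕ B → Plane) (chan : Link A B → Channel) {Λ m : ℝ}
    (hΛ0 : 0 ≤ Λ) (h0 : ∀ l, 0 ≤ M.rii (chan l) (linkDist pos l))
    (hΛ : ∀ l, M.rii (chan l) (linkDist pos l) ≤ Λ)
    (good : Finset A)
    (hgood : ∀ j ∈ good, ∀ u : Plane, Λ * ‖u‖ ^ 2 ≤
      ∑ b, M.rii (chan (anchorLink j b)) (linkDist pos (anchorLink j b)) *
        inner ℝ (linkDir pos (anchorLink j b)) u ^ 2)
    (hbad : Λ * goodᶜ.card ≤ m / 2) (i : A)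
    (hi : ∀ u : Plane, m * ‖u‖ ^ 2 ≤
      ∑ n, M.rii (chan (linkTo i n)) (linkDist pos (linkTo i n)) *
        inner ℝ (linkDir pos (linkTo i n)) u ^ 2) (x : A → Plane) :
    m / 4 * ‖x i‖ ^ 2 ≤ rangeForm M pos chan x := by
  set t : Link A B → ℝ := fun l => M.rii (chan l) (linkDist pos l) * rangeRate pos l x ^ 2 with ht
  have ht0 : ∀ l, 0 ≤ t l := fun l => mul_nonneg (h0 l) (sq_nonneg _)
  have hj : ∀ j ∈ good, Λ * ‖x j‖ ^ 2 ≤ ∑ n, t (linkTo j n) := by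
    intro j hj
    refine (hgood j hj (x j)).trans ?_
    have hinj : Function.Injective fun b : B =>
        (⟨Sum.inr b, Sum.inr_ne_inl⟩ : {n : A ⊕ B // n ≠ Sum.inl j}) := by
      intro b b' h
      simpa using h
    calc _ = ∑ b : B, t (linkTo j ⟨Sum.inr b, Sum.inr_ne_inl⟩) := by
          refine Finset.sum_congr rfl fun b _ => ?_
          simp [ht, rangeRate, anchorLink, linkTo]
      _ = ∑ n ∈ Finset.univ.map ⟨_, hinj⟩, t (linkTo j n) := by rw [Finset.sum_map]; rfl
      _ ≤ _ := Finset.sum_le_sum_of_subset_of_nonneg (Finset.subset_univ _) fun _ _ _ => ht0 _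
  have hform : (∑ n, t (linkTo i n)) + ∑ j ∈ good.erase i, Λ * ‖x j‖ ^ 2 ≤
      rangeForm M pos chan x := by
    have hni : i ∉ good.erase i := Finset.notMem_erase i good
    calc _ ≤ (∑ n, t (linkTo i n)) + ∑ j ∈ good.erase i, ∑ n, t (linkTo j n) := by
          gcongr with j hj'
          exact hj j (Finset.mem_of_mem_erase hj')
      _ = ∑ j ∈ insert i (good.erase i), ∑ n, t (linkTo j n) := by rw [Finset.sum_insert hni]
      _ ≤ ∑ j, ∑ n, t (linkTo j n) := Finset.sum_le_sum_of_subset_of_nonneg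
          (Finset.subset_univ _) fun _ _ _ => Finset.sum_nonneg fun _ _ => ht0 _
      _ = _ := (sum_link t).symm
  refine le_trans ?_ hform
  -- The loss allowed to each link of `i`: for a good neighbour it is what that neighbour's anchors
  -- pay, for a bad one half of the largest possible contribution of the link, for an anchor
  -- nothing.
  let w : A ⊕ B → ℝ := Sum.elim
    (fun j => if j ∈ good then Λ * ‖x j‖ ^ 2 else Λ * ‖x i‖ ^ 2 / 2) 0
  have hw : ∀ n : {n : A ⊕ B // n ≠ Sum.inl i},
      M.rii (chan (linkTo i n)) (linkDist pos (linkTo i n)) *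
        inner ℝ (linkDir pos (linkTo i n)) (x i) ^ 2 / 2 ≤ t (linkTo i n) + w n := by
    intro n
    have hl := h0 (linkTo i n)
    have hl' := hΛ (linkTo i n)
    set q := linkDir pos (linkTo i n)
    set lam := M.rii (chan (linkTo i n)) (linkDist pos (linkTo i n)) with hlam
    have hle : ∀ u, lam * inner ℝ q u ^ 2 ≤ Λ * ‖u‖ ^ 2 := by
      intro u
      have hb : |(inner ℝ q u : ℝ)| ≤ ‖u‖ :=
        (abs_real_inner_le_norm _ _).trans
          (mul_le_of_le_one_left (norm_nonneg _) (norm_linkDir_le _ _))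
      have hb2 : (inner ℝ q u : ℝ) ^ 2 ≤ ‖u‖ ^ 2 := by
        rw [← sq_abs]; gcongr
      exact mul_le_mul hl' hb2 (sq_nonneg _) (hl.trans hl')
    have htn : t (linkTo i n) = lam * (inner ℝ q (x i - Sum.elim x 0 n.1)) ^ 2 := rfl
    obtain ⟨j | b, hn⟩ := n
    · by_cases hg : j ∈ good
      · have hwn : w (Sum.inl j) = Λ * ‖x j‖ ^ 2 := by simp [w, hg]
        have := hle (x j)
        rw [hwn, htn, Sum.elim_inl, inner_sub_right]
        -- The identity used is `(s - t) ^ 2 + t ^ 2 - s ^ 2 / 2 = (s - 2 * t) ^ 2 / 2`.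
        nlinarith [mul_nonneg hl (sq_nonneg ((inner ℝ q (x i) : ℝ) - 2 * inner ℝ q (x j)))]
      · have hwn : w (Sum.inl j) = Λ * ‖x i‖ ^ 2 / 2 := by simp [w, hg]
        have := hle (x i)
        have := ht0 (linkTo i ⟨Sum.inl j, hn⟩)
        rw [hwn]
        linarith
    · have hwn : w (Sum.inr b) = 0 := rfl
      rw [hwn, htn, Sum.elim_inr]
      simp only [Pi.zero_apply, sub_zero]
      nlinarith [mul_nonneg hl (sq_nonneg (inner ℝ q (x i) : ℝ))]
  have hws : ∑ n : {n : A ⊕ B // n ≠ Sum.inl i}, w n ≤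
      (∑ j ∈ good.erase i, Λ * ‖x j‖ ^ 2) + m / 4 * ‖x i‖ ^ 2 := by
    have e1 : ∑ n : {n : A ⊕ B // n ≠ Sum.inl i}, w n =
        ∑ j ∈ Finset.univ.erase i, w (Sum.inl j) := by
      rw [← Finset.sum_subtype (Finset.univ.erase (Sum.inl i)) (by simp) w,
        ← Finset.filter_ne', Finset.sum_filter, Fintype.sum_sum_type, ← Finset.filter_ne',
        Finset.sum_filter]
      simp [w]
    rw [e1]
    have e2 : Finset.univ.erase i ⊆ good.erase i ∪ goodᶜ := by
      intro j hj
      by_cases hg : j ∈ good <;> simp_all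
    have hw0 : ∀ j, 0 ≤ w (Sum.inl j) := by
      intro j
      simp only [w, Sum.elim_inl]
      split_ifs <;> positivity
    have e3 : ∑ j ∈ goodᶜ, w (Sum.inl j) ≤ m / 4 * ‖x i‖ ^ 2 := by
      have : ∀ j ∈ goodᶜ, w (Sum.inl j) = Λ * ‖x i‖ ^ 2 / 2 := by
        intro j hj
        simp [w, Finset.mem_compl.1 hj]
      rw [Finset.sum_congr rfl this, Finset.sum_const, nsmul_eq_mul]
      nlinarith [mul_le_mul_of_nonneg_right hbad (sq_nonneg ‖x i‖)]
    have e4 : ∑ j ∈ good.erase i, w (Sum.inl j) = ∑ j ∈ good.erase i, Λ * ‖x j‖ ^ 2 := by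
      refine Finset.sum_congr rfl fun j hj => ?_
      simp [w, Finset.mem_of_mem_erase hj]
    calc _ ≤ ∑ j ∈ good.erase i ∪ goodᶜ, w (Sum.inl j) :=
          Finset.sum_le_sum_of_subset_of_nonneg e2 fun _ _ _ => hw0 _
      _ ≤ (∑ j ∈ good.erase i, w (Sum.inl j)) + ∑ j ∈ goodᶜ, w (Sum.inl j) := by
          rw [← Finset.sum_union_inter]
          exact le_add_of_nonneg_right (Finset.sum_nonneg fun _ _ => hw0 _)
      _ ≤ _ := by rw [e4]; gcongr
  have h1 := Finset.sum_le_sum fun n (_ : n ∈ Finset.univ) => hw n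
  rw [Finset.sum_add_distrib, ← Finset.sum_div] at h1
  linarith [hi (x i)]

end Network
end Localization

/-! ### Integrals of products over the links at a node -/

theorem Real.exp_neg_le_one_sub_half {w : ℝ} (h0 : 0 ≤ w) (h1 : w ≤ 1) :
    Real.exp (-w) ≤ 1 - w / 2 := by
  have h2 : 1 / (1 + w) ≤ 1 - w / 2 := by
    rw [div_le_iff₀ (by linarith)]
    nlinarith
  refine le_trans ?_ h2
  rw [Real.exp_neg, one_div]
  exact inv_anti₀ (by linarith) (by linarith [Real.add_one_le_exp w])

/-- Coordinates outside the range of `φ` receive the factor `1`, so that the product runs over all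
of `κ` and the integral factorizes. -/
theorem MeasureTheory.integral_prod_comp_injective {ι κ X : Type*} [Fintype ι] [Fintype κ]
    [MeasurableSpace X] (μ : Measure X) [IsProbabilityMeasure μ] {φ : ι → κ}
    (hφ : Function.Injective φ) (f : ι → X → ℝ) :
    ∫ x : κ → X, ∏ n, f n (x (φ n)) ∂(Measure.pi fun _ => μ) = ∏ n, ∫ x, f n x ∂μ := by
  have h1 : ∀ x : κ → X, ∏ n, f n (x (φ n)) =
      ∏ e, Function.extend φ f (fun _ _ => 1) e (x e) := by
    intro x
    refine Fintype.prod_of_injective φ hφ _ _ (fun e he => ?_) fun n => ?_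
    · rw [Function.extend_apply' _ _ _ (by simpa using he)]
    · rw [hφ.extend_apply]
  simp only [h1]
  rw [integral_fintype_prod_eq_prod]
  symm
  refine Fintype.prod_of_injective φ hφ _ _ (fun e he => ?_) fun n => ?_
  · rw [Function.extend_apply' _ _ _ (by simpa using he)]
    simp
  · rw [hφ.extend_apply]

/-- The waveforms that a node receives from other nodes are independent, given its position. -/
theorem MeasureTheory.integral_prod_star_le {ι V E X : Type*} [Fintype ι] [Fintype V] [Fintype E]
    [MeasurableSpace X] (μ : Measure X) [IsProbabilityMeasure μ] (ζ : Measure ℝ)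
    [IsProbabilityMeasure ζ] {f : X → X → ℝ → ℝ}
    (hf : Measurable fun p : X × X × ℝ => f p.1 p.2.1 p.2.2)
    (h0 : ∀ p p' z, 0 ≤ f p p' z) (h1 : ∀ p p' z, f p p' z ≤ 1) {ρ : ℝ}
    (hρ : ∀ᵐ p ∂μ, ∫ p', ∫ z, f p p' z ∂ζ ∂μ ≤ ρ)
    (i : V) {node : ι → V} (hnode : Function.Injective node) (hi : ∀ n, node n ≠ i)
    {link : ι → E} (hlink : Function.Injective link) :
    ∫ ω : (V → X) × (E → ℝ), ∏ n, f (ω.1 i) (ω.1 (node n)) (ω.2 (link n))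
      ∂((Measure.pi fun _ => μ).prod (Measure.pi fun _ => ζ)) ≤ ρ ^ Fintype.card ι := by
  classical
  have bdd : ∀ ω : (V → X) × (E → ℝ),
      ‖∏ n, f (ω.1 i) (ω.1 (node n)) (ω.2 (link n))‖ ≤ 1 := by
    intro ω
    rw [Real.norm_of_nonneg (Finset.prod_nonneg fun _ _ => h0 _ _ _)]
    exact Finset.prod_le_one (fun _ _ => h0 _ _ _) fun _ _ => h1 _ _ _
  have hm : Measurable fun ω : (V → X) × (E → ℝ) =>
      ∏ n, f (ω.1 i) (ω.1 (node n)) (ω.2 (link n)) := by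
    refine Finset.measurable_prod _ fun n _ => ?_
    have : Measurable fun ω : (V → X) × (E → ℝ) => (ω.1 i, ω.1 (node n), ω.2 (link n)) := by
      fun_prop
    exact hf.comp this
  rw [integral_prod _ (Integrable.of_bound hm.aestronglyMeasurable 1 (ae_of_all _ bdd))]
  set g : X → X → ℝ := fun p p' => ∫ z, f p p' z ∂ζ with hg
  have hgm : Measurable fun p : X × X => g p.1 p.2 := by
    refine (StronglyMeasurable.integral_prod_right (f := fun (p : X × X) z => f p.1 p.2 z) ?_).measurable
    have : Measurable fun p : (X × X) × ℝ => (p.1.1, p.1.2, p.2) := by fun_prop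
    exact (hf.comp this).stronglyMeasurable
  have hg0 : ∀ p p', 0 ≤ g p p' := fun p p' => integral_nonneg fun z => h0 _ _ _
  have hg1 : ∀ p p', g p p' ≤ 1 := by
    intro p p'
    have := norm_integral_le_of_norm_le_const (μ := ζ) (f := f p p') (C := 1)
      (ae_of_all _ fun z => by rw [Real.norm_of_nonneg (h0 _ _ _)]; exact h1 _ _ _)
    simpa using (le_abs_self _).trans this
  have e1 : ∀ x : V → X, ∫ y : E → ℝ, ∏ n, f (x i) (x (node n)) (y (link n))
      ∂(Measure.pi fun _ => ζ) = ∏ n, g (x i) (x (node n)) := fun x =>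
    integral_prod_comp_injective ζ hlink fun n z => f (x i) (x (node n)) z
  simp only [e1]
  -- The coordinate `i` is common to all factors and is split off; once it is fixed, the factors
  -- depend on distinct independent coordinates.
  let G : (Subtype (· = i) → X) × ({v : V // ¬ v = i} → X) → ℝ := fun p =>
    ∏ n, g (p.1 ⟨i, rfl⟩) (p.2 ⟨node n, hi n⟩)
  have hGm : Measurable G := by
    refine Finset.measurable_prod _ fun n _ => ?_
    have : Measurable fun p : (Subtype (· = i) → X) × ({v : V // ¬ v = i} → X) =>
      (p.1 ⟨i, rfl⟩, p.2 ⟨node n, hi n⟩) := by fun_prop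
    exact hgm.comp this
  have hGb : ∀ p, ‖G p‖ ≤ 1 := by
    intro p
    rw [Real.norm_of_nonneg (Finset.prod_nonneg fun _ _ => hg0 _ _)]
    exact Finset.prod_le_one (fun _ _ => hg0 _ _) fun _ _ => hg1 _ _
  have mp : MeasurePreserving (MeasurableEquiv.piEquivPiSubtypeProd (fun _ : V => X) (· = i))
      (Measure.pi fun _ => μ) ((Measure.pi fun _ : Subtype (· = i) => μ).prod
        (Measure.pi fun _ : {v : V // ¬ v = i} => μ)) := by
    convert measurePreserving_piEquivPiSubtypeProd (fun _ : V => μ) (· = i)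
  have e2 := mp.integral_comp' G
  have e3 : ∀ x : V → X, G (MeasurableEquiv.piEquivPiSubtypeProd (fun _ => X) (· = i) x) =
    ∏ n, g (x i) (x (node n)) := fun x => rfl
  simp only [e3] at e2
  have hGi : Integrable G ((Measure.pi fun _ : Subtype (· = i) => μ).prod
      (Measure.pi fun _ : {v : V // ¬ v = i} => μ)) :=
    Integrable.of_bound hGm.aestronglyMeasurable 1 (ae_of_all _ hGb)
  rw [e2, integral_prod _ hGi]
  have hinj : Function.Injective fun n => (⟨node n, hi n⟩ : {v : V // ¬ v = i}) := by
    intro n n' h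
    exact hnode (congrArg Subtype.val h)
  have e4 : ∀ x : Subtype (· = i) → X, ∫ y, G (x, y) ∂(Measure.pi fun _ => μ) =
      ∏ _n : ι, ∫ p', g (x ⟨i, rfl⟩) p' ∂μ := fun x =>
    integral_prod_comp_injective μ hinj fun n p' => g (x ⟨i, rfl⟩) p'
  simp only [e4, Finset.prod_const, Finset.card_univ]
  have hae : ∀ᵐ x ∂(Measure.pi fun _ : Subtype (· = i) => μ), ∫ p', g (x ⟨i, rfl⟩) p' ∂μ ≤ ρ :=
    (measurePreserving_eval (fun _ : Subtype (· = i) => μ) ⟨i, rfl⟩).quasiMeasurePreserving.ae hρ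
  have hnn : ∀ p, 0 ≤ ∫ p', g p p' ∂μ := fun p => integral_nonneg fun _ => hg0 _ _
  calc _ ≤ ∫ _x : Subtype (· = i) → X, ρ ^ Fintype.card ι ∂(Measure.pi fun _ => μ) := by
        refine integral_mono_of_nonneg (ae_of_all _ fun x => pow_nonneg (hnn _) _)
          (integrable_const _) ?_
        filter_upwards [hae] with x hx
        exact pow_le_pow_left₀ (hnn _) hx _
    _ = _ := by simp

/-! ### Gains of the links and their concentration -/

namespace Localization

/-- A lower estimate, between `0` and `1`, of the geometric part of the information in the
direction `v` that a node at `p` gets from a node at `p'`. -/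
noncomputable def geometricGain (r₀ : ℝ) (p p' v : Plane) : ℝ :=
  min 1 (max 0 (dist p p' - r₀)) * min 1 (inner ℝ (p - p') v ^ 2)

/-- A lower estimate, between `0` and `1`, of the information in the direction `v` that a node at
`p` gets from a node at `p'` with fading `z`. -/
noncomputable def linkGain (r₀ z₁ : ℝ) (v p p' : Plane) (z : ℝ) : ℝ :=
  max 0 (min 1 (z / z₁)) * geometricGain r₀ p p' v

theorem geometricGain_nonneg (r₀ : ℝ) (p p' v : Plane) : 0 ≤ geometricGain r₀ p p' v := by
  unfold geometricGain; positivity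

theorem geometricGain_le_one (r₀ : ℝ) (p p' v : Plane) : geometricGain r₀ p p' v ≤ 1 :=
  mul_le_one₀ (min_le_left _ _) (by positivity) (min_le_left _ _)

theorem linkGain_nonneg (r₀ z₁ : ℝ) (v p p' : Plane) (z : ℝ) : 0 ≤ linkGain r₀ z₁ v p p' z :=
  mul_nonneg (le_max_left _ _) (geometricGain_nonneg _ _ _ _)

theorem linkGain_le_one (r₀ z₁ : ℝ) (v p p' : Plane) (z : ℝ) : linkGain r₀ z₁ v p p' z ≤ 1 :=
  mul_le_one₀ (max_le zero_le_one (min_le_left _ _)) (geometricGain_nonneg _ _ _ _)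
    (geometricGain_le_one _ _ _ _)

theorem continuous_geometricGain (r₀ : ℝ) :
    Continuous fun q : Plane × Plane × Plane => geometricGain r₀ q.1 q.2.1 q.2.2 := by
  unfold geometricGain; fun_prop

theorem measurable_linkGain (r₀ z₁ : ℝ) (v : Plane) :
    Measurable fun q : Plane × Plane × ℝ => linkGain r₀ z₁ v q.1 q.2.1 q.2.2 := by
  refine Continuous.measurable ?_
  unfold linkGain
  have h1 : Continuous fun q : Plane × Plane × ℝ => geometricGain r₀ q.1 q.2.1 v :=
    (continuous_geometricGain r₀).comp (f := fun q : Plane × Plane × ℝ => (q.1, q.2.1, v))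
      (by fun_prop)
  fun_prop

/-- The set is the preimage of a proper subspace under the measure preserving map `p' ↦ p - p'`. -/
theorem volume_orthogonal_eq_zero (p v : Plane) (hv : ‖v‖ = 1) :
    volume {p' : Plane | inner ℝ (p - p') v = 0} = 0 := by
  let W : Submodule ℝ Plane := (Submodule.span ℝ {v})ᗮ
  have hW : volume (W : Set Plane) = 0 := by
    refine Measure.addHaar_submodule _ _ fun h => ?_
    have hvW : v ∈ W := by rw [h]; trivial
    have := Submodule.mem_orthogonal_singleton_iff_inner_left.1 hvW
    rw [real_inner_self_eq_norm_sq, hv] at this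
    norm_num at this
  have e : {p' : Plane | inner ℝ (p - p') v = 0} = (fun p' => p - p') ⁻¹' (W : Set Plane) := by
    ext p'
    exact Submodule.mem_orthogonal_singleton_iff_inner_left.symm
  rw [e, (Measure.measurePreserving_sub_left volume p).measure_preimage
    W.closed_of_finiteDimensional.measurableSet.nullMeasurableSet, hW]

/-- The mean gain is continuous in position and direction, hence attains its minimum on the compact
product of `closure S` and the circle. The minimum is positive because `hfar` leaves positive area
outside the disc, and only a null line there has zero gain. The truncations in `geometricGain` serve
this continuity. -/
theorem exists_le_integral_geometricGain {S : Set Plane} (hS : MeasurableSet S)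
    (hSb : Bornology.IsBounded S) (hS0 : 0 < volume S) (r₀ : ℝ)
    (hfar : ∀ x ∈ closure S, 0 < volume (S \ Metric.closedBall x r₀)) :
    ∃ η : ℝ, 0 < η ∧ ∀ p ∈ closure S, ∀ v : Plane, ‖v‖ = 1 →
      η ≤ ∫ p', geometricGain r₀ p p' v ∂(cond volume S) := by
  have hfin : volume S ≠ ⊤ := hSb.measure_lt_top.ne
  have : IsProbabilityMeasure (cond (volume : Measure Plane) S) :=
    cond_isProbabilityMeasure_of_finite hS0.ne' hfin
  have hcont : Continuous fun q : Plane × Plane =>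
      ∫ p', geometricGain r₀ q.1 p' q.2 ∂(cond volume S) := by
    refine continuous_of_dominated (bound := fun _ => 1) (fun q => ?_) (fun q => ?_)
      (integrable_const _) (ae_of_all _ fun p' => ?_)
    · exact ((continuous_geometricGain r₀).comp (f := fun p' => (q.1, p', q.2))
        (by fun_prop)).aestronglyMeasurable
    · exact ae_of_all _ fun p' => by
        rw [Real.norm_of_nonneg (geometricGain_nonneg _ _ _ _)]
        exact geometricGain_le_one _ _ _ _
    · exact (continuous_geometricGain r₀).comp (f := fun q : Plane × Plane => (q.1, p', q.2))
        (by fun_prop)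
  have hK : IsCompact (closure S ×ˢ Metric.sphere (0 : Plane) 1) :=
    hSb.isCompact_closure.prod (isCompact_sphere _ _)
  have hne : (closure S ×ˢ Metric.sphere (0 : Plane) 1).Nonempty := by
    refine Set.Nonempty.prod ?_ (NormedSpace.sphere_nonempty.2 zero_le_one)
    exact (nonempty_of_measure_ne_zero hS0.ne').closure
  obtain ⟨⟨p, v⟩, ⟨hp, hv⟩, hmin⟩ := hK.exists_isMinOn hne hcont.continuousOn
  refine ⟨_, ?_, fun p' hp' v' hv' => hmin (a := (p', v')) ⟨hp', by simpa using hv'⟩⟩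
  have hv1 : ‖v‖ = 1 := by simpa using hv
  have hint : Integrable (fun p' => geometricGain r₀ p p' v) (cond volume S) := by
    refine Integrable.of_bound ((continuous_geometricGain r₀).comp (f := fun p' => (p, p', v))
        (by fun_prop)).aestronglyMeasurable 1 (ae_of_all _ fun p' => ?_)
    rw [Real.norm_of_nonneg (geometricGain_nonneg _ _ _ _)]
    exact geometricGain_le_one _ _ _ _
  change 0 < ∫ p', geometricGain r₀ p p' v ∂(cond volume S)
  rw [integral_pos_iff_support_of_nonneg (fun _ => geometricGain_nonneg _ _ _ _) hint]
  rw [cond_apply hS]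
  refine ENNReal.mul_pos (by simpa using hfin) (ne_of_gt ?_)
  calc 0 < volume (S \ Metric.closedBall p r₀) := hfar p hp
    _ = volume ((S \ Metric.closedBall p r₀) \ {p' : Plane | inner ℝ (p - p') v = 0}) :=
        (measure_sdiff_null (volume_orthogonal_eq_zero p v hv1)).symm
    _ ≤ _ := by
      refine measure_mono fun p' ⟨⟨h1, h2⟩, h3⟩ => ⟨h1, ?_⟩
      have h4 : r₀ < dist p p' := by
        rw [dist_comm]; simpa using h2
      have h5 : (inner ℝ (p - p') v : ℝ) ≠ 0 := h3
      have : 0 < geometricGain r₀ p p' v := by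
        refine mul_pos (lt_min one_pos (lt_max_of_lt_right (by linarith)))
          (lt_min one_pos (by positivity))
      exact this.ne'

/-- The expected exponential of the negative gain is uniformly less than `1`. -/
theorem exists_integral_exp_linkGain_le {S : Set Plane} (hS : MeasurableSet S)
    (hSb : Bornology.IsBounded S) (hS0 : 0 < volume S) (r₀ : ℝ)
    (hfar : ∀ x ∈ closure S, 0 < volume (S \ Metric.closedBall x r₀))
    (ζ : Measure ℝ) [IsProbabilityMeasure ζ] (hζ0 : 0 < ζ (Set.Ioi 0)) {z₁ : ℝ} (hz : 0 < z₁) :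
    ∃ η : ℝ, 0 < η ∧ ∀ p ∈ closure S, ∀ v : Plane, ‖v‖ = 1 →
      ∫ p', ∫ z, Real.exp (-linkGain r₀ z₁ v p p' z) ∂ζ ∂(cond volume S) ≤ Real.exp (-(η / 2)) := by
  obtain ⟨η, hη, h⟩ := exists_le_integral_geometricGain hS hSb hS0 r₀ hfar
  have hfin : volume S ≠ ⊤ := hSb.measure_lt_top.ne
  have : IsProbabilityMeasure (cond (volume : Measure Plane) S) :=
    cond_isProbabilityMeasure_of_finite hS0.ne' hfin
  set c : ℝ → ℝ := fun z => max 0 (min 1 (z / z₁)) with hc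
  have hcc : Continuous c := by simp only [hc]; fun_prop
  have hc0 : ∀ z, 0 ≤ c z := fun z => le_max_left _ _
  have hc1 : ∀ z, c z ≤ 1 := fun z => max_le zero_le_one (min_le_left _ _)
  have hci : Integrable c ζ := Integrable.of_bound hcc.aestronglyMeasurable 1
    (ae_of_all _ fun z => by rw [Real.norm_of_nonneg (hc0 z)]; exact hc1 z)
  have hcpos : 0 < ∫ z, c z ∂ζ := by
    rw [integral_pos_iff_support_of_nonneg hc0 hci]
    refine hζ0.trans_le (measure_mono fun z hz0 => ?_)
    have : 0 < c z := lt_max_of_lt_right (lt_min one_pos (div_pos hz0 hz))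
    exact this.ne'
  -- Fading is independent of position, so the mean gain is at least this product. With `exp (-w) ≤
  -- 1 - w / 2` on `[0, 1]`, half of it survives in the exponent.
  refine ⟨(∫ z, c z ∂ζ) * η, by positivity, fun p hp v hv => ?_⟩
  have hgi : Integrable (fun p' => geometricGain r₀ p p' v) (cond volume S) := by
    refine Integrable.of_bound ((continuous_geometricGain r₀).comp (f := fun p' => (p, p', v))
        (by fun_prop)).aestronglyMeasurable 1 (ae_of_all _ fun p' => ?_)
    rw [Real.norm_of_nonneg (geometricGain_nonneg _ _ _ _)]
    exact geometricGain_le_one _ _ _ _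
  have h1 : ∀ p', ∫ z, Real.exp (-linkGain r₀ z₁ v p p' z) ∂ζ ≤
      1 - (∫ z, c z ∂ζ) * geometricGain r₀ p p' v / 2 := by
    intro p'
    have hi : Integrable (fun z => 1 - c z * geometricGain r₀ p p' v / 2) ζ :=
      (integrable_const _).sub ((hci.mul_const _).div_const _)
    calc _ ≤ ∫ z, (1 - c z * geometricGain r₀ p p' v / 2) ∂ζ := by
          refine integral_mono_of_nonneg (ae_of_all _ fun _ => (Real.exp_pos _).le) hi
            (ae_of_all _ fun z => ?_)
          exact Real.exp_neg_le_one_sub_half (linkGain_nonneg _ _ _ _ _ _)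
            (linkGain_le_one _ _ _ _ _ _)
      _ = _ := by
          rw [integral_sub (integrable_const _) ((hci.mul_const _).div_const _), integral_div,
            integral_mul_const]
          simp
  have hi2 : Integrable (fun p' => 1 - (∫ z, c z ∂ζ) * geometricGain r₀ p p' v / 2)
      (cond volume S) := (integrable_const _).sub ((hgi.const_mul _).div_const _)
  calc _ ≤ ∫ p', (1 - (∫ z, c z ∂ζ) * geometricGain r₀ p p' v / 2) ∂(cond volume S) :=
        integral_mono_of_nonneg
          (ae_of_all _ fun _ => integral_nonneg fun _ => (Real.exp_pos _).le) hi2 (ae_of_all _ h1)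
    _ = 1 - (∫ z, c z ∂ζ) * (∫ p', geometricGain r₀ p p' v ∂(cond volume S)) / 2 := by
        rw [integral_sub (integrable_const _) ((hgi.const_mul _).div_const _), integral_div,
          integral_const_mul]
        simp
    _ ≤ 1 - (∫ z, c z ∂ζ) * η / 2 := by
        gcongr
        exact h p hp v hv
    _ ≤ _ := Real.one_sub_le_exp_neg _

/-- Chernoff's bound for the gain of a node from other nodes. -/
theorem measure_sum_linkGain_le {ι V E : Type*} [Fintype ι] [Fintype V] [Fintype E]
    {S : Set Plane} (hS : MeasurableSet S) (hSb : Bornology.IsBounded S) (hS0 : 0 < volume S)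
    (ζ : Measure ℝ) [IsProbabilityMeasure ζ] {r₀ z₁ η : ℝ} {v : Plane}
    (hη : ∀ p ∈ closure S,
      ∫ p', ∫ z, Real.exp (-linkGain r₀ z₁ v p p' z) ∂ζ ∂(cond volume S) ≤ Real.exp (-(η / 2)))
    (i : V) {node : ι → V} (hnode : Function.Injective node) (hi : ∀ n, node n ≠ i)
    {link : ι → E} (hlink : Function.Injective link) :
    ((Measure.pi fun _ : V => cond volume S).prod (Measure.pi fun _ : E => ζ)).real
      {ω | ∑ n, linkGain r₀ z₁ v (ω.1 i) (ω.1 (node n)) (ω.2 (link n)) ≤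
        η / 4 * Fintype.card ι} ≤ Real.exp (-(η / 4 * Fintype.card ι)) := by
  have hfin : volume S ≠ ⊤ := hSb.measure_lt_top.ne
  have : IsProbabilityMeasure (cond (volume : Measure Plane) S) :=
    cond_isProbabilityMeasure_of_finite hS0.ne' hfin
  set Q := (Measure.pi fun _ : V => cond (volume : Measure Plane) S).prod
    (Measure.pi fun _ : E => ζ)
  set X : (V → Plane) × (E → ℝ) → ℝ := fun ω =>
    ∑ n, linkGain r₀ z₁ v (ω.1 i) (ω.1 (node n)) (ω.2 (link n)) with hX
  have hXm : Measurable X := by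
    refine Finset.measurable_sum _ fun n _ => ?_
    have : Measurable fun ω : (V → Plane) × (E → ℝ) => (ω.1 i, ω.1 (node n), ω.2 (link n)) := by
      fun_prop
    exact (measurable_linkGain r₀ z₁ v).comp this
  have hX0 : ∀ ω, 0 ≤ X ω := fun ω => Finset.sum_nonneg fun _ _ => linkGain_nonneg _ _ _ _ _ _
  have hint : Integrable (fun ω => Real.exp (-1 * X ω)) Q := by
    refine Integrable.of_bound (by fun_prop) 1 (ae_of_all _ fun ω => ?_)
    rw [Real.norm_of_nonneg (Real.exp_pos _).le, Real.exp_le_one_iff]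
    linarith [hX0 ω]
  refine (measure_le_le_exp_mul_mgf (η / 4 * Fintype.card ι) (by norm_num) hint).trans ?_
  have hmgf : mgf X Q (-1) ≤ Real.exp (-(η / 2)) ^ Fintype.card ι := by
    have hae : ∀ᵐ p ∂(cond volume S),
        ∫ p', ∫ z, Real.exp (-linkGain r₀ z₁ v p p' z) ∂ζ ∂(cond volume S) ≤
          Real.exp (-(η / 2)) := by
      filter_upwards [ae_cond_mem hS] with p hp
      exact hη p (subset_closure hp)
    have key := integral_prod_star_le (cond volume S) ζ
      (f := fun p p' z => Real.exp (-linkGain r₀ z₁ v p p' z))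
      ((measurable_linkGain r₀ z₁ v).neg.exp) (fun _ _ _ => (Real.exp_pos _).le)
      (fun p p' z => by
        rw [Real.exp_le_one_iff]; linarith [linkGain_nonneg r₀ z₁ v p p' z])
      hae i hnode hi hlink
    refine le_of_eq_of_le ?_ key
    rw [mgf]
    refine integral_congr_ae (ae_of_all _ fun ω => ?_)
    simp only [hX]
    rw [← Real.exp_sum, Finset.sum_neg_distrib, neg_one_mul]
  -- The threshold is half of the decay rate `η / 2`, which leaves `η / 4` per link.
  calc _ ≤ Real.exp (- -1 * (η / 4 * Fintype.card ι)) * Real.exp (-(η / 2)) ^ Fintype.card ι := by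
        gcongr
    _ = _ := by
        rw [← Real.exp_nat_mul, ← Real.exp_add]
        congr 1; ring

end Localization

/-! ### Error bounds for a fixed network with large gains -/

namespace Localization

section Network

variable {A B : Type} [Fintype A] [Fintype B] [DecidableEq A] [DecidableEq B]

/-- A network in which the ranging information intensities are at most `Λ`, and at least `κ` times
the gains of the links. -/
structure IsRegularNetwork (M : SignalModel) (r₀ z₁ κ Λ : ℝ) (pos : A ⊕ B → Plane)
    (Z : Link A B → ℝ) (chan : Link A B → Channel) : Prop where
  posDef : ∀ l, (M.linkFIM (chan l) (linkDist pos l)).toBlocks₂₂.PosDef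
  rii_nonneg : ∀ l, 0 ≤ M.rii (chan l) (linkDist pos l)
  rii_le : ∀ l, M.rii (chan l) (linkDist pos l) ≤ Λ
  gain_le : ∀ l v, κ * linkGain r₀ z₁ v (pos (Sum.inl l.1.1)) (pos l.1.2) (Z l) ≤
    M.rii (chan l) (linkDist pos l) * inner ℝ (linkDir pos l) v ^ 2

omit [Fintype A] [Fintype B] [DecidableEq A] [DecidableEq B] in
theorem IsRegularNetwork.solo {M : SignalModel} {r₀ z₁ κ Λ : ℝ} {pos : A ⊕ B → Plane}
    {Z : Link A B → ℝ} {chan : Link A B → Channel}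
    (h : IsRegularNetwork M r₀ z₁ κ Λ pos Z chan) (k : A) :
    IsRegularNetwork M r₀ z₁ κ Λ (pos ∘ Sum.map (fun _ : Unit => k) id) (Z ∘ soloLink k)
      (chan ∘ soloLink k) where
  posDef l := h.posDef (soloLink k l)
  rii_nonneg l := h.rii_nonneg (soloLink k l)
  rii_le l := h.rii_le (soloLink k l)
  gain_le l v := h.gain_le (soloLink k l) v

/-- The links in a family have large gains in the directions of a set `T`. -/
def HasLargeGains (r₀ z₁ η : ℝ) (T : Finset Plane) {ι : Type} [Fintype ι] (link : ι → Link A B)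
    (pos : A ⊕ B → Plane) (Z : Link A B → ℝ) : Prop :=
  ∀ v ∈ T, η / 4 * Fintype.card ι < ∑ n, linkGain r₀ z₁ v (pos (Sum.inl (link n).1.1))
    (pos (link n).1.2) (Z (link n))

-- Large gains give `κ * η / 4` per link in the directions of the net; passing to all directions
-- costs another factor `4`, hence the precision required in `hδ`.
omit [Fintype A] [Fintype B] [DecidableEq A] [DecidableEq B] in
theorem HasLargeGains.le_sum {M : SignalModel} {r₀ z₁ κ Λ η δ : ℝ} {T : Finset Plane}
    {pos : A ⊕ B → Plane} {Z : Link A B → ℝ} {chan : Link A B → Channel}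
    (hreg : IsRegularNetwork M r₀ z₁ κ Λ pos Z chan) (hκ : 0 ≤ κ) (hΛ : 0 ≤ Λ)
    (hT : ∀ u : Plane, ‖u‖ = 1 → ∃ v ∈ T, ‖u - v‖ ≤ δ) (hδ : Λ * δ ^ 2 ≤ κ * η / 16)
    {ι : Type} [Fintype ι] {link : ι → Link A B} (h : HasLargeGains r₀ z₁ η T link pos Z)
    (u : Plane) :
    κ * η / 16 * Fintype.card ι * ‖u‖ ^ 2 ≤
      ∑ n, M.rii (chan (link n)) (linkDist pos (link n)) * inner ℝ (linkDir pos (link n)) u ^ 2 := by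
  have key := le_sum_inner_sq_of_net (c := κ * η / 4) (fun n => hreg.rii_nonneg (link n))
    (fun n => hreg.rii_le (link n)) hΛ (fun n => norm_linkDir_le pos (link n)) hT
    (by linarith) (fun v hv => ?_) u
  · have e : κ * η / 4 / 4 = κ * η / 16 := by ring
    rwa [e] at key
  · calc κ * η / 4 * Fintype.card ι = κ * (η / 4 * Fintype.card ι) := by ring
      _ ≤ κ * ∑ n, linkGain r₀ z₁ v (pos (Sum.inl (link n).1.1)) (pos (link n).1.2)
          (Z (link n)) := by gcongr; exact (h v hv).le
      _ ≤ _ := by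
        rw [Finset.mul_sum]
        exact Finset.sum_le_sum fun n _ => hreg.gain_le (link n) v

theorem speb_bounds {M : SignalModel} {r₀ z₁ κ Λ m : ℝ}
    {pos : A ⊕ B → Plane} {Z : Link A B → ℝ} {chan : Link A B → Channel}
    (hreg : IsRegularNetwork M r₀ z₁ κ Λ pos Z chan) (hΛ : 0 ≤ Λ) (hm : 0 < m)
    (h : ∀ (x : A → Plane) (a : A), m * ‖x a‖ ^ 2 ≤ rangeForm M pos chan x) (k : A) :
    1 / (Λ * ((Fintype.card B : ℝ) + Fintype.card A)) ≤ speb M pos chan k ∧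
      speb M pos chan k ≤ 2 / m :=
  ⟨le_speb M pos chan hreg.posDef (posDef_fim M pos chan hreg.posDef hm h) hreg.rii_le hΛ k,
    speb_le M pos chan hreg.posDef hm h k⟩

omit [Fintype A] [DecidableEq A] in
theorem spebNoncoop_bounds {M : SignalModel} {r₀ z₁ κ Λ η δ : ℝ} {T : Finset Plane}
    {pos : A ⊕ B → Plane} {Z : Link A B → ℝ} {chan : Link A B → Channel}
    (hreg : IsRegularNetwork M r₀ z₁ κ Λ pos Z chan) (hκ : 0 < κ) (hη : 0 < η) (hΛ : 0 < Λ)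
    (hT : ∀ u : Plane, ‖u‖ = 1 → ∃ v ∈ T, ‖u - v‖ ≤ δ) (hδ : Λ * δ ^ 2 ≤ κ * η / 16)
    (hB : Λ ≤ κ * η / 32 * Fintype.card B) (k : A)
    (h : HasLargeGains r₀ z₁ η T (anchorLink (B := B) k) pos Z) :
    1 / (2 * Λ) * (1 / (Fintype.card B : ℝ)) ≤ spebNoncoop M pos chan k ∧
      spebNoncoop M pos chan k ≤ 128 / (κ * η) * (1 / (Fintype.card B : ℝ)) := by
  have hB0 : 0 < Fintype.card B := by
    by_contra hc
    have : Fintype.card B = 0 := by omega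
    rw [this] at hB
    simp at hB
    linarith
  have hB1 : (1 : ℝ) ≤ Fintype.card B := by exact_mod_cast hB0
  set pos' : Unit ⊕ B → Plane := pos ∘ Sum.map (fun _ : Unit => k) id with hpos'
  set chan' : Link Unit B → Channel := chan ∘ soloLink k with hchan'
  have hreg' := hreg.solo k
  have hform : ∀ (x : Unit → Plane) (a : Unit),
      κ * η / 16 * Fintype.card B / 4 * ‖x a‖ ^ 2 ≤ rangeForm M pos' chan' x := by
    intro x a
    -- With no good agents the only agent counts as bad, and `hB` absorbs this single term.
    refine le_rangeForm M pos' chan' hΛ.le hreg'.rii_nonneg hreg'.rii_le ∅ (by simp) ?_ a ?_ x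
    · simp only [Finset.compl_empty, Finset.card_univ, Fintype.card_unit, Nat.cast_one, mul_one]
      linarith
    · intro u
      refine (h.le_sum hreg hκ.le hΛ.le hT hδ u).trans (le_of_eq ?_)
      refine Fintype.sum_bijective (fun b : B =>
        (⟨Sum.inr b, Sum.inr_ne_inl⟩ : {n : Unit ⊕ B // n ≠ Sum.inl a})) ⟨?_, ?_⟩ _ _ ?_
      · intro b b' h
        simpa using h
      · rintro ⟨n | b, hn⟩
        · exact absurd rfl hn
        · exact ⟨b, rfl⟩
      · intro b
        rfl
  have key := speb_bounds hreg' hΛ.le (by positivity) hform ()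
  refine ⟨le_trans ?_ key.1, key.2.trans (le_of_eq ?_)⟩
  · rw [Fintype.card_unit, Nat.cast_one, div_mul_div_comm, one_mul]
    refine one_div_le_one_div_of_le (by positivity) ?_
    nlinarith
  · field_simp
    norm_num

theorem card_ne_inl (i : A) : ((Fintype.card {n : A ⊕ B // n ≠ Sum.inl i} : ℕ) : ℝ) =
    (Fintype.card B : ℝ) + Fintype.card A - 1 := by
  have h1 : Fintype.card {n : A ⊕ B // n ≠ Sum.inl i} = Fintype.card A + Fintype.card B - 1 := by
    rw [Fintype.card_subtype_compl, Fintype.card_sum, Fintype.card_subtype_eq]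
  have h2 : 0 < Fintype.card A := Fintype.card_pos_iff.2 ⟨i⟩
  rw [h1, Nat.cast_sub (by omega)]
  push_cast
  ring

/-- `le_rangeForm` is used with `m = κ * η / 32 * (Nb + Na)`, where `Nb` and `Na` are the numbers of
anchors and agents: `hB` lets the anchors of a good agent pay `Λ`, and the proportion in `hbad` is
chosen so that the bad links cost at most `m / 2`. -/
theorem speb_bounds_of_hasLargeGains {M : SignalModel} {r₀ z₁ κ Λ η δ : ℝ} {T : Finset Plane}
    {pos : A ⊕ B → Plane} {Z : Link A B → ℝ} {chan : Link A B → Channel}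
    (hreg : IsRegularNetwork M r₀ z₁ κ Λ pos Z chan) (hκ : 0 < κ) (hη : 0 < η) (hΛ : 0 < Λ)
    (hT : ∀ u : Plane, ‖u‖ = 1 → ∃ v ∈ T, ‖u - v‖ ≤ δ) (hδ : Λ * δ ^ 2 ≤ κ * η / 16)
    (hB : Λ ≤ κ * η / 32 * Fintype.card B) (good : Finset A)
    (hgood : ∀ j ∈ good, HasLargeGains r₀ z₁ η T (anchorLink (B := B) j) pos Z)
    (hbad : (goodᶜ.card : ℝ) ≤ κ * η / (64 * Λ) * Fintype.card A)
    (h : ∀ i, HasLargeGains r₀ z₁ η T (linkTo (B := B) i) pos Z) (k : A) :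
    1 / Λ * (1 / ((Fintype.card B : ℝ) + Fintype.card A)) ≤ speb M pos chan k ∧
      speb M pos chan k ≤ 256 / (κ * η) * (1 / ((Fintype.card B : ℝ) + Fintype.card A)) := by
  have hB0 : 0 < Fintype.card B := by
    by_contra hc
    have : Fintype.card B = 0 := by omega
    rw [this] at hB
    simp at hB
    linarith
  have hB1 : (1 : ℝ) ≤ Fintype.card B := by exact_mod_cast hB0
  have hA1 : (1 : ℝ) ≤ Fintype.card A := by exact_mod_cast Fintype.card_pos_iff.2 ⟨k⟩
  have hκη : 0 < κ * η := by positivity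
  have hform : ∀ (x : A → Plane) (a : A),
      κ * η / 32 * ((Fintype.card B : ℝ) + Fintype.card A) / 4 * ‖x a‖ ^ 2 ≤
        rangeForm M pos chan x := by
    intro x a
    refine le_rangeForm M pos chan hΛ.le hreg.rii_nonneg hreg.rii_le good ?_ ?_ a ?_ x
    · intro j hj u
      refine le_trans ?_ ((hgood j hj).le_sum hreg hκ.le hΛ.le hT hδ u)
      gcongr
      nlinarith
    · calc Λ * (goodᶜ.card : ℝ) ≤ Λ * (κ * η / (64 * Λ) * Fintype.card A) := by gcongr
        _ = κ * η / 64 * Fintype.card A := by field_simp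
        _ ≤ _ := by nlinarith
    · intro u
      refine le_trans ?_ ((h a).le_sum hreg hκ.le hΛ.le hT hδ u)
      -- An agent receives from `Nb + Na - 1` nodes, at least half of `Nb + Na`; this is where `16`
      -- becomes `32`.
      rw [card_ne_inl]
      gcongr ?_ * _
      nlinarith
  have key := speb_bounds hreg hΛ.le (by positivity) hform k
  refine ⟨le_trans (le_of_eq ?_) key.1, key.2.trans (le_of_eq ?_)⟩
  · rw [div_mul_div_comm, one_mul]
  · field_simp
    norm_num

/-! ### Random networks -/

/-- The law of the positions and the fading variables. -/
noncomputable abbrev networkLaw (A B : Type) [Fintype A] [Fintype B] [DecidableEq A]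
    [DecidableEq B] (S : Set Plane) (ζ : Measure ℝ) :
    Measure ((A ⊕ B → Plane) × (Link A B → ℝ)) :=
  (Measure.pi fun _ => cond volume S).prod (Measure.pi fun _ => ζ)

theorem not_hasLargeGains_le
    {S : Set Plane} (hS : MeasurableSet S) (hSb : Bornology.IsBounded S) (hS0 : 0 < volume S)
    (ζ : Measure ℝ) [IsProbabilityMeasure ζ] {r₀ z₁ η : ℝ} {T : Finset Plane}
    (hT1 : ∀ v ∈ T, ‖v‖ = 1)
    (hη : ∀ p ∈ closure S, ∀ v : Plane, ‖v‖ = 1 →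
      ∫ p', ∫ z, Real.exp (-linkGain r₀ z₁ v p p' z) ∂ζ ∂(cond volume S) ≤ Real.exp (-(η / 2)))
    {ι : Type} [Fintype ι] {link : ι → Link A B} (i : A) (hi : ∀ n, (link n).1.1 = i)
    (hinj : Function.Injective link) :
    (networkLaw A B S ζ).real {ω | ¬ HasLargeGains r₀ z₁ η T link ω.1 ω.2} ≤
      T.card * Real.exp (-(η / 4 * Fintype.card ι)) := by
  have hfin : volume S ≠ ⊤ := hSb.measure_lt_top.ne
  have : IsProbabilityMeasure (cond (volume : Measure Plane) S) :=
    cond_isProbabilityMeasure_of_finite hS0.ne' hfin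
  have e : {ω : (A ⊕ B → Plane) × (Link A B → ℝ) | ¬ HasLargeGains r₀ z₁ η T link ω.1 ω.2} ⊆
      ⋃ v ∈ T, {ω | ∑ n, linkGain r₀ z₁ v (ω.1 (Sum.inl i)) (ω.1 (link n).1.2) (ω.2 (link n)) ≤
        η / 4 * Fintype.card ι} := by
    intro ω hω
    simp only [HasLargeGains, Set.mem_ofPred_eq, hi] at hω
    push Not at hω
    simpa using hω
  refine (measureReal_mono e (measure_ne_top _ _)).trans ((measureReal_biUnion_finset_le _ _).trans ?_)
  rw [← nsmul_eq_mul]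
  refine Finset.sum_le_card_nsmul _ _ _ fun v hv => ?_
  refine measure_sum_linkGain_le hS hSb hS0 ζ (fun p hp => hη p hp v (hT1 v hv)) (Sum.inl i)
    (node := fun n => (link n).1.2) (fun n n' h => hinj ?_) (fun n h => (link n).2 ?_) hinj
  · exact Subtype.ext (Prod.ext ((hi n).trans (hi n').symm) h)
  · rw [hi n]; exact h

omit [Fintype A] [Fintype B] [DecidableEq A] [DecidableEq B] in
theorem anchorLink_injective (i : A) : Function.Injective (anchorLink (B := B) i) := by
  intro b b' h
  simpa [anchorLink] using h

omit [Fintype A] [Fintype B] [DecidableEq A] [DecidableEq B] in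
theorem linkTo_injective (i : A) : Function.Injective (linkTo (B := B) i) := by
  intro n n' h
  exact Subtype.ext (congrArg (fun l : Link A B => l.1.2) h)

omit [Fintype A] [Fintype B] [DecidableEq A] [DecidableEq B] in
theorem measurableSet_hasLargeGains (r₀ z₁ η : ℝ) (T : Finset Plane) {ι : Type} [Fintype ι]
    (link : ι → Link A B) : MeasurableSet {ω : (A ⊕ B → Plane) × (Link A B → ℝ) |
      HasLargeGains r₀ z₁ η T link ω.1 ω.2} := by
  have e : {ω : (A ⊕ B → Plane) × (Link A B → ℝ) | HasLargeGains r₀ z₁ η T link ω.1 ω.2} =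
      ⋂ v ∈ T, {ω | η / 4 * Fintype.card ι < ∑ n, linkGain r₀ z₁ v (ω.1 (Sum.inl (link n).1.1))
        (ω.1 (link n).1.2) (ω.2 (link n))} := by
    ext ω; simp [HasLargeGains]
  rw [e]
  refine Finset.measurableSet_biInter _ fun v _ => measurableSet_lt measurable_const ?_
  refine Finset.measurable_sum _ fun n _ => ?_
  have : Measurable fun ω : (A ⊕ B → Plane) × (Link A B → ℝ) =>
    (ω.1 (Sum.inl (link n).1.1), ω.1 (link n).1.2, ω.2 (link n)) := by fun_prop
  exact (measurable_linkGain r₀ z₁ v).comp this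

end Network

/-- Markov's inequality for the number of events that occur. -/
theorem measure_card_filter_ge_le {Ω ι : Type*} [MeasurableSpace Ω] [Fintype ι] [Nonempty ι]
    (Q : Measure Ω)
    [IsProbabilityMeasure Q] {bad : ι → Set Ω} (hm : ∀ i, MeasurableSet (bad i)) {p : ℝ}
    (hp : ∀ i, Q.real (bad i) ≤ p) {θ : ℝ} (hθ : 0 < θ) :
    open scoped Classical in
    Q.real {ω | θ * Fintype.card ι < ((Finset.univ.filter fun i => ω ∈ bad i).card : ℝ)} ≤
      p / θ := by
  classical
  have hc : (0 : ℝ) < Fintype.card ι := by exact_mod_cast Fintype.card_pos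
  set f : Ω → ℝ := fun ω => ∑ i, (bad i).indicator (fun _ => (1 : ℝ)) ω with hf
  have hfi : ∀ i, Integrable ((bad i).indicator fun _ => (1 : ℝ)) Q := fun i =>
    (integrable_const _).indicator (hm i)
  have hfeq : ∀ ω, ((Finset.univ.filter fun i => ω ∈ bad i).card : ℝ) = f ω := by
    intro ω
    simp [hf, Set.indicator_apply]
  have h1 := mul_meas_ge_le_integral_of_nonneg (μ := Q) (f := f)
    (ae_of_all _ fun ω => Finset.sum_nonneg fun i _ =>
      Set.indicator_nonneg (fun _ _ => zero_le_one) _)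
    (integrable_finsetSum _ fun i _ => hfi i) (θ * Fintype.card ι)
  have h2 : ∫ ω, f ω ∂Q ≤ Fintype.card ι * p := by
    simp only [hf]
    rw [integral_finsetSum _ fun i _ => hfi i]
    simp only [integral_indicator_const _ (hm _), smul_eq_mul, mul_one]
    refine (Finset.sum_le_card_nsmul _ _ p fun i _ => hp i).trans ?_
    simp
  have h3 : Q.real {ω | θ * Fintype.card ι < ((Finset.univ.filter fun i => ω ∈ bad i).card : ℝ)} ≤
      Q.real {ω | θ * Fintype.card ι ≤ f ω} := by
    refine measureReal_mono fun ω hω => ?_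
    simp only [Set.mem_ofPred_eq, hfeq] at hω ⊢
    exact hω.le
  refine h3.trans ?_
  rw [le_div_iff₀ hθ]
  have h4 := h1.trans h2
  nlinarith

/-- Only subadditivity and `Measure.le_map_apply` are used, so neither `F` nor `s` has to be
measurable. This matters because `chan`, and with it the error, is an arbitrary function of the
sample point. -/
theorem one_sub_le_measure_of_hasLaw {Ω X : Type*} [MeasurableSpace Ω] [MeasurableSpace X]
    {P : Measure Ω} [IsProbabilityMeasure P] {Q : Measure X} [IsFiniteMeasure Q] {Y : Ω → X}
    (hY : HasLaw Y Q P) {F : Set X} {ε : ℝ} (hF : Q.real F ≤ ε) {s : Set Ω}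
    (hs : ∀ᵐ ω ∂P, Y ω ∉ F → ω ∈ s) : 1 - ε ≤ P.real s := by
  have h1 : P.real (Y ⁻¹' F) ≤ Q.real F := by
    have := Measure.le_map_apply hY.aemeasurable F
    rw [hY.map_eq] at this
    exact ENNReal.toReal_mono (measure_ne_top _ _) this
  have h2 : P.real (s ∪ Y ⁻¹' F) = 1 := by
    have h3 : (s ∪ Y ⁻¹' F : Set Ω) =ᵐ[P] (Set.univ : Set Ω) := by
      refine eventuallyEq_univ.2 ?_
      filter_upwards [hs] with ω hω
      by_cases h : Y ω ∈ F
      · exact Or.inr h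
      · exact Or.inl (hω h)
    rw [measureReal_congr h3, probReal_univ]
  have := measureReal_union_le (μ := P) s (Y ⁻¹' F)
  linarith

theorem IsDenseNetwork.hasLaw {M : SignalModel} {S : Set Plane} {r₀ b : ℝ} {ζ : Measure ℝ}
    {Na Nb : ℕ} {Ω : Type*} [MeasurableSpace Ω] {P : Measure Ω}
    {pos : Ω → Fin Na ⊕ Fin Nb → Plane} {Z : Ω → Link (Fin Na) (Fin Nb) → ℝ}
    {chan : Ω → Link (Fin Na) (Fin Nb) → Channel} (h : IsDenseNetwork M S r₀ b ζ P pos Z chan) :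
    HasLaw (fun ω => (pos ω, Z ω)) (networkLaw (Fin Na) (Fin Nb) S ζ) P :=
  h.law

/-- Almost every realization of a dense network is regular. -/
theorem IsDenseNetwork.ae_isRegularNetwork {M : SignalModel} {S : Set Plane}
    (hS : MeasurableSet S) (hSb : Bornology.IsBounded S) (hS0 : 0 < volume S) {r₀ b z₁ D : ℝ}
    (hr₀ : 0 < r₀) (hb : 0 < b) (hD : ∀ p ∈ S, ∀ p' ∈ S, dist p p' ≤ D) (hD0 : 0 < D)
    (hz : 0 < z₁) {ζ : Measure ℝ} [IsProbabilityMeasure ζ] (hζ : ∀ᵐ z ∂ζ, 0 ≤ z ∧ z ≤ z₁)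
    {Na Nb : ℕ} {Ω : Type*} [MeasurableSpace Ω] {P : Measure Ω}
    {pos : Ω → Fin Na ⊕ Fin Nb → Plane} {Z : Ω → Link (Fin Na) (Fin Nb) → ℝ}
    {chan : Ω → Link (Fin Na) (Fin Nb) → Channel} (h : IsDenseNetwork M S r₀ b ζ P pos Z chan) :
    ∀ᵐ ω ∂P, IsRegularNetwork M r₀ z₁ (z₁ / (D ^ (2 * b) * D ^ 2)) (z₁ / r₀ ^ (2 * b))
      (pos ω) (Z ω) (chan ω) := by
  have hfin : volume S ≠ ⊤ := hSb.measure_lt_top.ne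
  have : IsProbabilityMeasure (cond (volume : Measure Plane) S) :=
    cond_isProbabilityMeasure_of_finite hS0.ne' hfin
  have hpos : ∀ᵐ ω ∂P, ∀ n, pos ω n ∈ S := by
    have hQ : ∀ᵐ q ∂(networkLaw (Fin Na) (Fin Nb) S ζ), ∀ n, q.1 n ∈ S := by
      rw [ae_all_iff]
      intro n
      exact (measurePreserving_fst.quasiMeasurePreserving.ae
        ((measurePreserving_eval (fun _ : Fin Na ⊕ Fin Nb => cond volume S)
          n).quasiMeasurePreserving.ae (ae_cond_mem hS)))
    rw [← h.hasLaw.map_eq] at hQ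
    exact ae_of_ae_map h.law.aemeasurable hQ
  have hfad : ∀ᵐ ω ∂P, ∀ l, 0 ≤ Z ω l ∧ Z ω l ≤ z₁ := by
    have hQ : ∀ᵐ q ∂(networkLaw (Fin Na) (Fin Nb) S ζ), ∀ l, 0 ≤ q.2 l ∧ q.2 l ≤ z₁ := by
      rw [ae_all_iff]
      intro l
      exact (measurePreserving_snd.quasiMeasurePreserving.ae
        ((measurePreserving_eval (fun _ : Link (Fin Na) (Fin Nb) => ζ)
          l).quasiMeasurePreserving.ae hζ))
    rw [← h.hasLaw.map_eq] at hQ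
    exact ae_of_ae_map h.law.aemeasurable hQ
  filter_upwards [hpos, hfad, h.identifiable, h.rii_eq] with ω hp hf hid hr
  refine ⟨hid, fun l => ?_, fun l => ?_, fun l v => ?_⟩
  · rw [hr l]
    split_ifs with hl
    · exact div_nonneg (hf l).1 (Real.rpow_nonneg dist_nonneg _)
    · exact le_rfl
  · rw [hr l]
    split_ifs with hl
    · have := (hf l).2
      gcongr
    · positivity
  · rw [hr l]
    set d := linkDist (pos ω) l with hd
    have hd' : dist (pos ω (Sum.inl l.1.1)) (pos ω l.1.2) = d := rfl
    split_ifs with hl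
    · have hd0 : 0 < d := hr₀.trans_le hl
      have hdD : d ≤ D := hD _ (hp _) _ (hp _)
      have e : (inner ℝ (linkDir (pos ω) l) v : ℝ) ^ 2 =
          inner ℝ (pos ω (Sum.inl l.1.1) - pos ω l.1.2) v ^ 2 / d ^ 2 := by
        rw [linkDir, real_inner_smul_left, ← hd]
        field_simp
      have hg : geometricGain r₀ (pos ω (Sum.inl l.1.1)) (pos ω l.1.2) v ≤
          inner ℝ (pos ω (Sum.inl l.1.1) - pos ω l.1.2) v ^ 2 :=
        (mul_le_of_le_one_left (by positivity) (min_le_left _ _)).trans (min_le_right _ _)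
      have hz' : max 0 (min 1 (Z ω l / z₁)) ≤ Z ω l / z₁ :=
        max_le (div_nonneg (hf l).1 hz.le) (min_le_right _ _)
      have hzn := (hf l).1
      rw [e]
      calc _ ≤ z₁ / (D ^ (2 * b) * D ^ 2) *
            (Z ω l / z₁ * inner ℝ (pos ω (Sum.inl l.1.1) - pos ω l.1.2) v ^ 2) := by
            unfold linkGain
            gcongr
            exact geometricGain_nonneg _ _ _ _
        _ = Z ω l * inner ℝ (pos ω (Sum.inl l.1.1) - pos ω l.1.2) v ^ 2 /
            (D ^ (2 * b) * D ^ 2) := by field_simp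
        _ ≤ Z ω l * inner ℝ (pos ω (Sum.inl l.1.1) - pos ω l.1.2) v ^ 2 /
            (d ^ (2 * b) * d ^ 2) := by gcongr
        _ = _ := by rw [div_mul_div_comm]
    · have : max 0 (dist (pos ω (Sum.inl l.1.1)) (pos ω l.1.2) - r₀) = 0 := by
        rw [hd', max_eq_left]; linarith
      simp [linkGain, geometricGain, this]

/-- The probability of failure that is allowed to a network with `Nb` anchors. -/
noncomputable def failureBound (K a N₀ : ℝ) (Nb : ℕ) : ℝ :=
  K * Real.exp (-(a * Nb)) + if N₀ ≤ Nb then 0 else 1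

theorem tendsto_failureBound (K : ℝ) {a : ℝ} (ha : 0 < a) (N₀ : ℝ) :
    Tendsto (failureBound K a N₀) atTop (𝓝 0) := by
  have h1 : Tendsto (fun n : ℕ => K * Real.exp (-(a * n))) atTop (𝓝 (K * 0)) := by
    refine Tendsto.const_mul _ (Real.tendsto_exp_neg_atTop_nhds_zero.comp ?_)
    exact tendsto_natCast_atTop_atTop.const_mul_atTop ha
  have h2 : Tendsto (fun n : ℕ => if N₀ ≤ n then (0 : ℝ) else 1) atTop (𝓝 0) := by
    refine tendsto_const_nhds.congr' ?_
    filter_upwards [tendsto_natCast_atTop_atTop.eventually_ge_atTop N₀] with n hn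
    rw [if_pos hn]
  have h3 := h1.add h2
  rw [mul_zero, add_zero] at h3
  exact h3

end Localization

/-! ### Probability of failure, and the theorem -/

namespace Localization

theorem one_sub_failureBound_le_measure_noncoop {M : SignalModel} {S : Set Plane}
    (hS : MeasurableSet S) (hSb : Bornology.IsBounded S) (hS0 : 0 < volume S)
    {r₀ b z₁ κ Λ η δ : ℝ} {T : Finset Plane} (hκ : 0 < κ) (hη : 0 < η) (hΛ : 0 < Λ)
    (ζ : Measure ℝ) [IsProbabilityMeasure ζ] (hT1 : ∀ v ∈ T, ‖v‖ = 1)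
    (hexp : ∀ p ∈ closure S, ∀ v : Plane, ‖v‖ = 1 →
      ∫ p', ∫ z, Real.exp (-linkGain r₀ z₁ v p p' z) ∂ζ ∂(cond volume S) ≤ Real.exp (-(η / 2)))
    (hT : ∀ u : Plane, ‖u‖ = 1 → ∃ v ∈ T, ‖u - v‖ ≤ δ) (hδ : Λ * δ ^ 2 ≤ κ * η / 16)
    {Na Nb : ℕ} {Ω : Type*} [MeasurableSpace Ω] {P : Measure Ω} [IsProbabilityMeasure P]
    {pos : Ω → Fin Na ⊕ Fin Nb → Plane} {Z : Ω → Link (Fin Na) (Fin Nb) → ℝ}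
    {chan : Ω → Link (Fin Na) (Fin Nb) → Channel} (h : IsDenseNetwork M S r₀ b ζ P pos Z chan)
    (hreg : ∀ᵐ ω ∂P, IsRegularNetwork M r₀ z₁ κ Λ (pos ω) (Z ω) (chan ω)) (k : Fin Na) :
    1 - failureBound T.card (η / 4) (32 * Λ / (κ * η)) Nb ≤ P.real {ω |
      1 / (2 * Λ) * (1 / (Nb : ℝ)) ≤ spebNoncoop M (pos ω) (chan ω) k ∧
      spebNoncoop M (pos ω) (chan ω) k ≤ 128 / (κ * η) * (1 / (Nb : ℝ))} := by
  have : IsProbabilityMeasure (cond (volume : Measure Plane) S) :=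
    cond_isProbabilityMeasure_of_finite hS0.ne' hSb.measure_lt_top.ne
  by_cases hN : 32 * Λ / (κ * η) ≤ Nb
  · refine one_sub_le_measure_of_hasLaw h.hasLaw
      (F := {ω | ¬ HasLargeGains r₀ z₁ η T (anchorLink k) ω.1 ω.2}) ?_ ?_
    · rw [failureBound, if_pos hN, add_zero]
      simpa using not_hasLargeGains_le hS hSb hS0 ζ hT1 hexp (link := anchorLink (B := Fin Nb) k) k
        (fun _ => rfl) (anchorLink_injective k)
    · filter_upwards [hreg] with ω hω hF
      have hB : Λ ≤ κ * η / 32 * Fintype.card (Fin Nb) := by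
        rw [div_le_iff₀ (by positivity)] at hN
        rw [Fintype.card_fin]
        linarith
      simpa using spebNoncoop_bounds hω hκ hη hΛ hT hδ hB k (not_not.1 hF)
  -- With too few anchors the allowed failure probability is at least `1`.
  · rw [failureBound, if_neg hN]
    have : 0 ≤ (T.card : ℝ) * Real.exp (-(η / 4 * Nb)) := by positivity
    refine le_trans ?_ measureReal_nonneg
    linarith

/-- Makes the union bound over `x` agents uniform in `x`: the factor `x` is absorbed by `exp (η / 4
* x)`. -/
theorem mul_exp_neg_le {η : ℝ} (hη : 0 < η) (x y : ℝ) :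
    x * Real.exp (-(η / 4 * (y + x - 1))) ≤
      4 / η * Real.exp (η / 4) * Real.exp (-(η / 4 * y)) := by
  have h1 : η / 4 * x ≤ Real.exp (η / 4 * x) := by linarith [Real.add_one_le_exp (η / 4 * x)]
  have h2 : x ≤ 4 / η * Real.exp (η / 4 * x) := by
    rw [div_mul_eq_mul_div, le_div_iff₀ hη]
    linarith
  calc _ ≤ 4 / η * Real.exp (η / 4 * x) * Real.exp (-(η / 4 * (y + x - 1))) := by gcongr
    _ = _ := by
      rw [mul_assoc, mul_assoc, ← Real.exp_add, ← Real.exp_add]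
      congr 2
      ring

theorem one_sub_failureBound_le_measure_coop {M : SignalModel} {S : Set Plane}
    (hS : MeasurableSet S) (hSb : Bornology.IsBounded S) (hS0 : 0 < volume S)
    {r₀ b z₁ κ Λ η δ : ℝ} {T : Finset Plane} (hκ : 0 < κ) (hη : 0 < η) (hΛ : 0 < Λ)
    (ζ : Measure ℝ) [IsProbabilityMeasure ζ] (hT1 : ∀ v ∈ T, ‖v‖ = 1)
    (hexp : ∀ p ∈ closure S, ∀ v : Plane, ‖v‖ = 1 →
      ∫ p', ∫ z, Real.exp (-linkGain r₀ z₁ v p p' z) ∂ζ ∂(cond volume S) ≤ Real.exp (-(η / 2)))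
    (hT : ∀ u : Plane, ‖u‖ = 1 → ∃ v ∈ T, ‖u - v‖ ≤ δ) (hδ : Λ * δ ^ 2 ≤ κ * η / 16)
    {Na Nb : ℕ} {Ω : Type*} [MeasurableSpace Ω] {P : Measure Ω} [IsProbabilityMeasure P]
    {pos : Ω → Fin Na ⊕ Fin Nb → Plane} {Z : Ω → Link (Fin Na) (Fin Nb) → ℝ}
    {chan : Ω → Link (Fin Na) (Fin Nb) → Channel} (h : IsDenseNetwork M S r₀ b ζ P pos Z chan)
    (hreg : ∀ᵐ ω ∂P, IsRegularNetwork M r₀ z₁ κ Λ (pos ω) (Z ω) (chan ω)) (k : Fin Na) :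
    1 - failureBound (T.card * (4 / η * Real.exp (η / 4) + 64 * Λ / (κ * η))) (η / 4)
        (32 * Λ / (κ * η)) Nb ≤ P.real {ω |
      1 / Λ * (1 / ((Nb : ℝ) + (Na : ℝ))) ≤ speb M (pos ω) (chan ω) k ∧
      speb M (pos ω) (chan ω) k ≤ 256 / (κ * η) * (1 / ((Nb : ℝ) + (Na : ℝ)))} := by
  classical
  have : IsProbabilityMeasure (cond (volume : Measure Plane) S) :=
    cond_isProbabilityMeasure_of_finite hS0.ne' hSb.measure_lt_top.ne
  have : Nonempty (Fin Na) := ⟨k⟩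
  by_cases hN : 32 * Λ / (κ * η) ≤ Nb
  · set θ := κ * η / (64 * Λ) with hθ
    have hθ0 : 0 < θ := by positivity
    set Q := networkLaw (Fin Na) (Fin Nb) S ζ with hQ
    let F₁ : Fin Na → Set ((Fin Na ⊕ Fin Nb → Plane) × (Link (Fin Na) (Fin Nb) → ℝ)) :=
      fun i => {ω | ¬ HasLargeGains r₀ z₁ η T (linkTo i) ω.1 ω.2}
    let bad : Fin Na → Set ((Fin Na ⊕ Fin Nb → Plane) × (Link (Fin Na) (Fin Nb) → ℝ)) :=
      fun i => {ω | ¬ HasLargeGains r₀ z₁ η T (anchorLink i) ω.1 ω.2}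
    -- The event that more than the tolerated proportion `θ` of agents is badly localized by
    -- anchors. Markov's inequality costs the factor `1 / θ`, independent of `Na`.
    let F₂ := {ω | θ * Fintype.card (Fin Na) <
      ((Finset.univ.filter fun i => ω ∈ bad i).card : ℝ)}
    have hF₁ : Q.real (⋃ i, F₁ i) ≤
        T.card * (4 / η * Real.exp (η / 4)) * Real.exp (-(η / 4 * Nb)) := by
      refine (measureReal_iUnion_fintype_le _).trans ?_
      have h1 : ∀ i ∈ Finset.univ, Q.real (F₁ i) ≤
          T.card * Real.exp (-(η / 4 * ((Nb : ℝ) + Na - 1))) := by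
        intro i _
        have key := not_hasLargeGains_le hS hSb hS0 ζ hT1 hexp (link := linkTo (B := Fin Nb) i) i
          (fun _ => rfl) (linkTo_injective i)
        rw [card_ne_inl, Fintype.card_fin, Fintype.card_fin] at key
        exact key
      refine (Finset.sum_le_card_nsmul _ _ _ h1).trans ?_
      rw [nsmul_eq_mul, Finset.card_univ, Fintype.card_fin]
      have := mul_le_mul_of_nonneg_left (mul_exp_neg_le hη Na Nb) (Nat.cast_nonneg T.card)
      linarith
    have hF₂ : Q.real F₂ ≤ T.card * Real.exp (-(η / 4 * Nb)) / θ := by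
      have key := measure_card_filter_ge_le Q (bad := bad)
        (fun i => (measurableSet_hasLargeGains r₀ z₁ η T (anchorLink i)).compl)
        (p := T.card * Real.exp (-(η / 4 * Nb)))
        (fun i => by
          simpa using not_hasLargeGains_le hS hSb hS0 ζ hT1 hexp
            (link := anchorLink (B := Fin Nb) i) i (fun _ => rfl) (anchorLink_injective i)) hθ0
      convert key
    refine one_sub_le_measure_of_hasLaw h.hasLaw (F := (⋃ i, F₁ i) ∪ F₂) ?_ ?_
    · refine (measureReal_union_le _ _).trans ((add_le_add hF₁ hF₂).trans (le_of_eq ?_))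
      rw [failureBound, if_pos hN, add_zero, hθ]
      field_simp
    · filter_upwards [hreg] with ω hω hF
      have hB : Λ ≤ κ * η / 32 * Fintype.card (Fin Nb) := by
        rw [div_le_iff₀ (by positivity)] at hN
        rw [Fintype.card_fin]
        linarith
      simp only [Set.mem_union, Set.mem_iUnion, not_or, not_exists] at hF
      have key := speb_bounds_of_hasLargeGains hω hκ hη hΛ hT hδ hB
        (Finset.univ.filter fun i => (pos ω, Z ω) ∉ bad i)
        (fun j hj => not_not.1 (Finset.mem_filter.1 hj).2) ?_ (fun i => not_not.1 (hF.1 i)) k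
      · simpa using key
      · have h2 : ((Finset.univ.filter fun i => (pos ω, Z ω) ∈ bad i).card : ℝ) ≤
            θ * Fintype.card (Fin Na) := not_lt.1 hF.2
        rw [Finset.compl_filter]
        simpa only [not_not] using h2
  · rw [failureBound, if_neg hN]
    refine le_trans ?_ measureReal_nonneg
    have : 0 ≤ (T.card * (4 / η * Real.exp (η / 4) + 64 * Λ / (κ * η))) *
      Real.exp (-(η / 4 * Nb)) := by positivity
    linarith

theorem exists_finset_net_sphere {δ : ℝ} (hδ : 0 < δ) :
    ∃ T : Finset Plane, (∀ v ∈ T, ‖v‖ = 1) ∧ ∀ u : Plane, ‖u‖ = 1 → ∃ v ∈ T, ‖u - v‖ ≤ δ := by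
  obtain ⟨t, ht, hfin, hcov⟩ :=
    (isCompact_sphere (0 : Plane) 1).finite_cover_balls hδ
  refine ⟨hfin.toFinset, fun v hv => by simpa using ht (hfin.mem_toFinset.1 hv), fun u hu => ?_⟩
  have := hcov (show u ∈ Metric.sphere (0 : Plane) 1 by simpa using hu)
  simp only [Set.mem_iUnion, Metric.mem_ball, dist_eq_norm] at this
  obtain ⟨v, hv, huv⟩ := this
  exact ⟨v, hfin.mem_toFinset.2 hv, huv.le⟩

end Localization

theorem theorem5 (M : Localization.SignalModel)
    (S : Set Localization.Plane) (hS : MeasurableSet S) (hSb : Bornology.IsBounded S)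
    (hS0 : 0 < volume S)
    (r₀ b : ℝ) (hr₀ : 0 < r₀) (hb : 0 < b)
    (hfar : ∀ x ∈ closure S, 0 < volume (S \ Metric.closedBall x r₀))
    (ζ : Measure ℝ) [IsProbabilityMeasure ζ]
    (z₁ : ℝ) (hζ : ∀ᵐ z ∂ζ, 0 ≤ z ∧ z ≤ z₁) (hζ0 : 0 < ζ (Set.Ioi 0)) :
    (∃ c₁ c₂ : ℝ, 0 < c₁ ∧ c₁ < c₂ ∧ ∃ ε : ℕ → ℝ, Tendsto ε atTop (𝓝 0) ∧
      ∀ (Na Nb : ℕ) (Ω : Type u) [MeasurableSpace Ω] (P : Measure Ω) [IsProbabilityMeasure P]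
        (pos : Ω → Fin Na ⊕ Fin Nb → Localization.Plane)
        (Z : Ω → Localization.Link (Fin Na) (Fin Nb) → ℝ)
        (chan : Ω → Localization.Link (Fin Na) (Fin Nb) → Localization.Channel),
        Localization.IsDenseNetwork M S r₀ b ζ P pos Z chan →
        ∀ k : Fin Na,
          1 - ε Nb ≤ P.real {ω |
            c₁ * (1 / (Nb : ℝ)) ≤ Localization.spebNoncoop M (pos ω) (chan ω) k ∧
            Localization.spebNoncoop M (pos ω) (chan ω) k ≤ c₂ * (1 / (Nb : ℝ))}) ∧
    (∃ c₁ c₂ : ℝ, 0 < c₁ ∧ c₁ < c₂ ∧ ∃ ε : ℕ → ℝ, Tendsto ε atTop (𝓝 0) ∧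
      ∀ (Na Nb : ℕ) (Ω : Type u) [MeasurableSpace Ω] (P : Measure Ω) [IsProbabilityMeasure P]
        (pos : Ω → Fin Na ⊕ Fin Nb → Localization.Plane)
        (Z : Ω → Localization.Link (Fin Na) (Fin Nb) → ℝ)
        (chan : Ω → Localization.Link (Fin Na) (Fin Nb) → Localization.Channel),
        Localization.IsDenseNetwork M S r₀ b ζ P pos Z chan →
        ∀ k : Fin Na,
          1 - ε Nb ≤ P.real {ω |
            c₁ * (1 / ((Nb : ℝ) + (Na : ℝ))) ≤ Localization.speb M (pos ω) (chan ω) k ∧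
            Localization.speb M (pos ω) (chan ω) k ≤ c₂ * (1 / ((Nb : ℝ) + (Na : ℝ)))}) := by
  -- The fading is positive with positive probability and almost surely at most `z₁`.
  have hz : 0 < z₁ := by
    by_contra! hc
    refine hζ0.ne' (measure_mono_null (fun z hz => ?_) (ae_iff.1 hζ))
    intro h
    exact absurd hz (not_lt.2 (h.2.trans hc))
  obtain ⟨D, hD⟩ := Metric.isBounded_iff.1 hSb
  have hD' : ∀ p ∈ S, ∀ p' ∈ S, dist p p' ≤ max D 1 := fun p hp p' hp' =>
    (hD hp hp').trans (le_max_left _ _)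
  have hD0 : (0 : ℝ) < max D 1 := lt_max_of_lt_right one_pos
  obtain ⟨η, hη, hexp⟩ :=
    Localization.exists_integral_exp_linkGain_le hS hSb hS0 r₀ hfar ζ hζ0 hz
  set κ := z₁ / (max D 1 ^ (2 * b) * max D 1 ^ 2) with hκ
  set Λ := z₁ / r₀ ^ (2 * b) with hΛ
  have hκ0 : 0 < κ := by positivity
  have hΛ0 : 0 < Λ := by positivity
  have hδ0 : 0 < κ * η / (16 * Λ) := by positivity
  obtain ⟨T, hT1, hT⟩ := Localization.exists_finset_net_sphere (Real.sqrt_pos.2 hδ0)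
  have hδ : Λ * √(κ * η / (16 * Λ)) ^ 2 ≤ κ * η / 16 := by
    rw [Real.sq_sqrt hδ0.le]
    refine le_of_eq ?_
    field_simp
  have hlt : ∀ x y : ℝ, x < max y (x + 1) := fun x y => lt_max_of_lt_right (lt_add_one x)
  -- All constants were fixed before the network. The maximum only secures `c₁ < c₂`.
  refine ⟨⟨1 / (2 * Λ), max (128 / (κ * η)) (1 / (2 * Λ) + 1), by positivity, hlt _ _,
      Localization.failureBound T.card (η / 4) (32 * Λ / (κ * η)),
      Localization.tendsto_failureBound _ (by positivity) _, ?_⟩,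
    ⟨1 / Λ, max (256 / (κ * η)) (1 / Λ + 1), by positivity, hlt _ _,
      Localization.failureBound (T.card * (4 / η * Real.exp (η / 4) + 64 * Λ / (κ * η))) (η / 4)
        (32 * Λ / (κ * η)), Localization.tendsto_failureBound _ (by positivity) _, ?_⟩⟩
  · intro Na Nb Ω _ P _ pos Z chan h k
    refine (Localization.one_sub_failureBound_le_measure_noncoop hS hSb hS0 hκ0 hη hΛ0 ζ hT1 hexp
      hT hδ h (h.ae_isRegularNetwork hS hSb hS0 hr₀ hb hD' hD0 hz hζ) k).trans ?_
    refine measureReal_mono fun ω hω => ⟨hω.1, hω.2.trans ?_⟩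
    gcongr
    exact le_max_left _ _
  · intro Na Nb Ω _ P _ pos Z chan h k
    refine (Localization.one_sub_failureBound_le_measure_coop hS hSb hS0 hκ0 hη hΛ0 ζ hT1 hexp
      hT hδ h (h.ae_isRegularNetwork hS hSb hS0 hr₀ hb hD' hD0 hz hζ) k).trans ?_
    refine measureReal_mono fun ω hω => ⟨hω.1, hω.2.trans ?_⟩
    gcongr
    exact le_max_left _ _
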